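/- We work in the hyperbolic plane $\mathbb{H}^2$. A convex body is a compact convex set with non-empty interior. A line supports a convex body $C$ if it meets $C$ and $C$ lies in one of the two closed half-planes bounded by it. For a line $L$ supporting $C$, $\mathrm{width}_L(C)$ is the distance between $L$ and a farthest line that is ultraparallel to $L$ and supports $C$; the thickness $\Delta(C)$ is the infimum of $\mathrm{width}_L(C)$ over all lines $L$ supporting $C$. A convex body $R$ is reduced if $\Delta(Z)<\Delta(R)$ for every convex body $Z$ properly contained in $R$. Let $n\ge 3$ be odd. An ordinary reduced $n$-gon is a convex $n$-gon $V=v_1v_2\dots v_n$ (with successive vertices in the positive orientation, indices modulo $n$) which is reduced and such that for every $i$ the projection of $v_i$ onto the line $L_i$ containing the side $v_{i+(n-1)/2}\,v_{i+(n+1)/2}$ lies in the relative interior of this side and the distance from $v_i$ to $L_i$ equals $\Delta(V)$. **Proposition.** Let $V=v_1\dots v_n$ be an ordinary reduced $n$-gon in $\mathbb{H}^2$. Its diameter is attained, and only by pairs of vertices whose indices differ by $(n-1)/2$ or $(n+1)/2$ modulo $n$: there are $i,j$ with $j\equiv i+(n-1)/2$ or $j\equiv i+(n+1)/2 \pmod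 n$ and $|v_iv_j|=\mathrm{diam}(V)$; and if $p,q\in V$ satisfy $|pq|=\mathrm{diam}(V)$, then $p=v_i$ and $q=v_j$ for some $i,j$ with $j\equiv i+(n-1)/2$ or $j\equiv i+(n+1)/2 \pmod n$. -/

import Mathlib

noncomputable section

namespace HypPlane

/-- The hyperbolic plane in the hyperboloid model: the upper sheet
`x₃ = √(x₁² + x₂² + 1)` in `ℝ³`, with the induced topology. -/
abbrev H2 : Type := {x : Fin 3 → ℝ // x 2 = Real.sqrt (x 0 ^ 2 + x 1 ^ 2 + 1)}

/-- The Lorentz form on `ℝ³`. -/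
def form (x y : Fin 3 → ℝ) : ℝ := x 0 * y 0 + x 1 * y 1 - x 2 * y 2

/-- The hyperbolic distance. -/
def hdist (p q : H2) : ℝ := Real.arcosh (-form p.1 q.1)

/-- The geodesic segment joining two points. -/
def seg (p q : H2) : Set H2 :=
  {x | ∃ a b : ℝ, 0 ≤ a ∧ 0 ≤ b ∧ x.1 = a • p.1 + b • q.1}

/-- The geodesic segment without its end points (for `p ≠ q`): the relative interior of `seg p q`. -/
def openSeg (p q : H2) : Set H2 :=
  {x | ∃ a b : ℝ, 0 < a ∧ 0 < b ∧ x.1 = a • p.1 + b • q.1}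

/-- The geodesic line through two different points. -/
def lineThrough (p q : H2) : Set H2 :=
  {x | ∃ a b : ℝ, x.1 = a • p.1 + b • q.1}

/-- `L` is the (straight) line with space-like normal vector `u`, of Lorentz length one.
The two half-planes bounded by `L` are `{x | 0 ≤ form x u}` and `{x | form x u ≤ 0}`. -/
def IsLineWithNormal (L : Set H2) (u : Fin 3 → ℝ) : Prop :=
  form u u = 1 ∧ L = {x : H2 | form x.1 u = 0}

/-- Two lines are ultraparallel: they have neither an ordinary nor an ideal point in common. In
terms of unit normals this means that their Lorentz product has absolute value greater than one. -/
def Ultraparallel (L M : Set H2) : Prop :=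
  ∃ u w : Fin 3 → ℝ, IsLineWithNormal L u ∧ IsLineWithNormal M w ∧ 1 < |form u w|

/-- The distance of a point from a set. -/
def distToSet (p : H2) (S : Set H2) : ℝ := sInf {r : ℝ | ∃ x ∈ S, r = hdist p x}

/-- The distance between two sets. -/
def setDist (S T : Set H2) : ℝ := sInf {r : ℝ | ∃ x ∈ S, ∃ y ∈ T, r = hdist x y}

/-- `q` is the projection of `p` onto the line `L`: the point of `L` nearest to `p`. -/
def IsProjection (p : H2) (L : Set H2) (q : H2) : Prop :=
  q ∈ L ∧ ∀ x ∈ L, hdist p q ≤ hdist p x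

/-- Geodesic convexity. -/
def IsConvex (C : Set H2) : Prop := ∀ p ∈ C, ∀ q ∈ C, seg p q ⊆ C

/-- The convex hull: the smallest convex set containing `S`. -/
def hull (S : Set H2) : Set H2 := ⋂₀ {C : Set H2 | IsConvex C ∧ S ⊆ C}

/-- A convex body: a compact convex set with non-empty interior. -/
def IsConvexBody (C : Set H2) : Prop :=
  IsConvex C ∧ IsCompact C ∧ (interior C).Nonempty

/-- The line `L` supports `C`: it meets `C`, and `C` lies in one of the closed half-planes
bounded by `L`. -/
def Supports (L C : Set H2) : Prop :=
  (L ∩ C).Nonempty ∧ ∃ u : Fin 3 → ℝ, IsLineWithNormal L u ∧ ∀ x ∈ C, 0 ≤ form x.1 u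

/-- The width of `C` determined by the supporting line `L`: the distance between `L` and a
farthest ultraparallel line supporting `C`. -/
def width (L C : Set H2) : ℝ :=
  sSup {r : ℝ | ∃ M : Set H2, Supports M C ∧ Ultraparallel L M ∧ r = setDist L M}

/-- The thickness of `C`: the infimum of the widths over all supporting lines. -/
def thickness (C : Set H2) : ℝ := sInf {r : ℝ | ∃ L : Set H2, Supports L C ∧ r = width L C}

/-- The diameter. -/
def hdiam (C : Set H2) : ℝ := sSup {r : ℝ | ∃ p ∈ C, ∃ q ∈ C, r = hdist p q}

/-- A reduced body: a convex body such that every convex body properly contained in it has smaller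
thickness. -/
def IsReduced (R : Set H2) : Prop :=
  IsConvexBody R ∧ ∀ Z : Set H2, IsConvexBody Z → Z ⊂ R → thickness Z < thickness R

/-- `V` is the convex `n`-gon with successive vertices `v i`, in the positive orientation (indices
modulo `n`): `V` is the convex hull of the `v i`, no `v i` is in the convex hull of the others, and
walking from `v i` to `v (i + 1)` one has all other vertices strictly on the left hand side. -/
def IsConvexPolygon (n : ℕ) (V : Set H2) (v : ZMod n → H2) : Prop :=
  3 ≤ n ∧ V = hull (Set.range v) ∧
    (∀ i, v i ∉ hull (v '' {j | j ≠ i})) ∧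
    ∀ i j, j ≠ i → j ≠ i + 1 →
      0 < Matrix.det (Matrix.of ![(v i).1, (v (i + 1)).1, (v j).1])

/-- `V` is an ordinary reduced `n`-gon with successive vertices `v i`: `n` is odd, `V` is a reduced
convex `n`-gon, and for every `i` the projection of `v i` onto the line containing the opposite side
`v (i + (n - 1) / 2)`, `v (i + (n + 1) / 2)` is in the relative interior of this side, and the
distance of `v i` from this line is the thickness of `V`. -/
def IsOrdinaryReducedPolygon (n : ℕ) (V : Set H2) (v : ZMod n → H2) : Prop :=
  Odd n ∧ IsConvexPolygon n V v ∧ IsReduced V ∧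
    ∀ i : ZMod n,
      let a := v (i + ((n - 1) / 2 : ℕ))
      let b := v (i + ((n + 1) / 2 : ℕ))
      (∃ q ∈ openSeg a b, IsProjection (v i) (lineThrough a b) q) ∧
        distToSet (v i) (lineThrough a b) = thickness V

end HypPlane

end

/-! Reducedness enters through one fact, `IsStarPolygon.height_le`: no vertex is farther from a side
than the vertex opposite to that side. In the hyperboloid model the height of `x` over the line with
normal `u` is `form x u / lnorm u`, the hyperbolic sine of a signed distance. On the tangent plane
at a point, `lnorm` is a Euclidean norm, so the directions at that point in which `x` has height at
least `c` form a convex cone (`height_combination`). The supporting directions at a vertex fill the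
cone of its two side normals. The axis towards the opposite side splits this cone, and the two ends
of that side are high enough on the two halves.

Suppose that a vertex `v x` is strictly higher than `v s` over the side opposite to `v s`. Cut off a
small corner at `v s` orthogonally to the axis. The directions for which `v s` was the witness are
then shared by `v x`, near the side normal, and by an end of the cut, near `v s`. At the ends of the
cut the old ends of the opposite side suffice. So the thickness does not decrease (`exists_cut`,
`le_thickness`), contradicting reducedness.

For the diameter, farthest points are vertices (`mem_of_farthest`). If `v j` and `v (j + k)` with `0
< k < m = (n - 1) / 2` were farthest, measure angles at `v j` from the side to `v (j - 1)`. Then `v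
(j + k)` has a larger angle than `v (j + m)` but no larger height over that side, hence is closer to
`v j` (`not_farthest`). -/

namespace HypPlane

open Filter Topology

/-! Bilinear algebra of the Lorentz form. -/

theorem form_comm (x y : Fin 3 → ℝ) : form x y = form y x := by
  simp only [form]; ring

@[simp] theorem form_add_left (x y z : Fin 3 → ℝ) : form (x + y) z = form x z + form y z := by
  simp only [form, Pi.add_apply]; ring

@[simp] theorem form_add_right (x y z : Fin 3 → ℝ) : form x (y + z) = form x y + form x z := by
  simp only [form, Pi.add_apply]; ring

@[simp] theorem form_sub_left (x y z : Fin 3 → ℝ) : form (x - y) z = form x z - form y z := by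
  simp only [form, Pi.sub_apply]; ring

@[simp] theorem form_sub_right (x y z : Fin 3 → ℝ) : form x (y - z) = form x y - form x z := by
  simp only [form, Pi.sub_apply]; ring

@[simp] theorem form_neg_left (x y : Fin 3 → ℝ) : form (-x) y = -form x y := by
  simp only [form, Pi.neg_apply]; ring

@[simp] theorem form_neg_right (x y : Fin 3 → ℝ) : form x (-y) = -form x y := by
  simp only [form, Pi.neg_apply]; ring

@[simp] theorem form_smul_left (a : ℝ) (x y : Fin 3 → ℝ) : form (a • x) y = a * form x y := by
  simp only [form, Pi.smul_apply, smul_eq_mul]; ring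

@[simp] theorem form_smul_right (a : ℝ) (x y : Fin 3 → ℝ) : form x (a • y) = a * form x y := by
  simp only [form, Pi.smul_apply, smul_eq_mul]; ring

@[simp] theorem form_zero_right (x : Fin 3 → ℝ) : form x 0 = 0 := by simp [form]

theorem continuous_form : Continuous fun p : (Fin 3 → ℝ) × (Fin 3 → ℝ) => form p.1 p.2 := by
  unfold form; fun_prop

/-- The Lorentz cross product: `form x (cross a b)` is the determinant of `a, b, x`. -/
def cross (a b : Fin 3 → ℝ) : Fin 3 → ℝ :=
  ![a 1 * b 2 - a 2 * b 1, a 2 * b 0 - a 0 * b 2, -(a 0 * b 1 - a 1 * b 0)]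

theorem form_cross_eq_det (a b x : Fin 3 → ℝ) :
    form x (cross a b) = Matrix.det (Matrix.of ![a, b, x]) := by
  simp [form, cross, Matrix.det_fin_three]; ring

@[simp] theorem form_cross_left (a b : Fin 3 → ℝ) : form a (cross a b) = 0 := by
  simp [form, cross]; ring

@[simp] theorem form_cross_right (a b : Fin 3 → ℝ) : form b (cross a b) = 0 := by
  simp [form, cross]; ring

theorem form_cross_rotate (a b c : Fin 3 → ℝ) : form c (cross a b) = form a (cross b c) := by
  simp [form, cross]; ring

theorem form_cross_swap (a b c : Fin 3 → ℝ) : form c (cross a b) = -form c (cross b a) := by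
  simp [form, cross]; ring

theorem cross_add_right (a b c : Fin 3 → ℝ) : cross a (b + c) = cross a b + cross a c := by
  ext i; fin_cases i <;> simp [cross] <;> ring

theorem cross_smul_right (r : ℝ) (a b : Fin 3 → ℝ) : cross a (r • b) = r • cross a b := by
  ext i; fin_cases i <;> simp [cross] <;> ring

@[simp] theorem cross_self (a : Fin 3 → ℝ) : cross a a = 0 := by
  ext i; fin_cases i <;> simp [cross] <;> ring

/-- Expansion of a vector in the basis dual to `y, a, z`. -/
theorem dual_expansion (y a z u : Fin 3 → ℝ) :
    form z (cross y a) • u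
      = form u z • cross y a + form u y • cross a z + form u a • cross z y := by
  ext i; fin_cases i <;> simp [cross, form] <;> ring

/-- The linear relation between four vectors, paired with a fifth one. -/
theorem four_vectors (v z a b e : Fin 3 → ℝ) :
    form b (cross v a) * form e z - form b (cross v z) * form e a + form a (cross v z) * form e b
      = form b (cross z a) * form e v := by
  simp [form, cross]; ring

/-- Expansion of a vector along the plane of `a, b` and its normal. -/
theorem normal_expansion (a b x : Fin 3 → ℝ) :
    form (cross a b) (cross a b) • x = form x (cross a b) • cross a b
      + (form a b * form x b - form b b * form x a) • a
      + (form a b * form x a - form a a * form x b) • b := by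
  ext i; fin_cases i <;> simp [cross, form, Matrix.vecHead, Matrix.vecTail] <;> ring

/-- The Gram determinant. -/
theorem sq_form_cross (z v x : Fin 3 → ℝ) :
    form x (cross z v) ^ 2 = -(form x x * form z z * form v v
      + 2 * form x z * form z v * form x v - form x x * form z v ^ 2
      - form z z * form x v ^ 2 - form v v * form x z ^ 2) := by
  simp [form, cross]; ring

/-! Points of the hyperbolic plane. -/

theorem H2.sq (p : H2) : p.1 2 ^ 2 = p.1 0 ^ 2 + p.1 1 ^ 2 + 1 := by
  rw [p.2, Real.sq_sqrt (by positivity)]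

theorem H2.pos (p : H2) : 0 < p.1 2 := by
  rw [p.2]; positivity

@[simp] theorem form_self (p : H2) : form p.1 p.1 = -1 := by
  have := p.sq
  simp only [form]; nlinarith

/-- A vector of Lorentz square `-1` on the upper sheet, as a point. -/
theorem exists_point {y : Fin 3 → ℝ} (h : form y y = -1) (h2 : 0 < y 2) :
    ∃ p : H2, p.1 = y := by
  refine ⟨⟨y, ?_⟩, rfl⟩
  rw [eq_comm, Real.sqrt_eq_iff_mul_self_eq (by positivity) h2.le]
  simp only [form] at h; nlinarith

/-- Eliminating `p 2` by orthogonality leaves Cauchy–Schwarz in the first two coordinates. The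
tangent plane at a point is thereby positive definite. -/
theorem form_orth_bound (a : H2) {p : Fin 3 → ℝ} (h : form a.1 p = 0) :
    p 0 ^ 2 + p 1 ^ 2 ≤ a.1 2 ^ 2 * form p p := by
  have ha := a.sq
  simp only [form] at h ⊢
  have h1 : a.1 2 * p 2 = a.1 0 * p 0 + a.1 1 * p 1 := by linarith
  have h2 : (a.1 2 * p 2) ^ 2 = (a.1 0 * p 0 + a.1 1 * p 1) ^ 2 := by rw [h1]
  have h3 : a.1 2 ^ 2 * (p 0 * p 0 + p 1 * p 1 - p 2 * p 2)
      = a.1 2 ^ 2 * (p 0 ^ 2 + p 1 ^ 2) - (a.1 2 * p 2) ^ 2 := by ring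
  rw [h3, h2, ha]
  nlinarith [sq_nonneg (a.1 0 * p 1 - a.1 1 * p 0)]

theorem form_orth_nonneg (a : H2) {p : Fin 3 → ℝ} (h : form a.1 p = 0) : 0 ≤ form p p := by
  have h1 := form_orth_bound a h
  have h2 : 0 < a.1 2 ^ 2 := by have := a.pos; positivity
  by_contra! h3
  nlinarith [sq_nonneg (p 0), sq_nonneg (p 1)]

theorem form_orth_eq_zero (a : H2) {p : Fin 3 → ℝ} (h : form a.1 p = 0) (hp : form p p = 0) :
    p = 0 := by
  have h1 := form_orth_bound a h
  rw [hp, mul_zero] at h1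
  have h0 : p 0 = 0 := by nlinarith [sq_nonneg (p 0), sq_nonneg (p 1)]
  have h1' : p 1 = 0 := by nlinarith [sq_nonneg (p 0), sq_nonneg (p 1)]
  have h2 : p 2 = 0 := by
    simp only [form, h0, h1'] at hp; nlinarith
  ext i; fin_cases i <;> simp [h0, h1', h2]

theorem form_orth_pos (a : H2) {p : Fin 3 → ℝ} (h : form a.1 p = 0) (hp : p ≠ 0) :
    0 < form p p :=
  lt_of_le_of_ne (form_orth_nonneg a h) fun h' => hp (form_orth_eq_zero a h h'.symm)

theorem form_orth_cauchy (a : H2) {p q : Fin 3 → ℝ} (hp : form a.1 p = 0) (hq : form a.1 q = 0) :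
    form p q ^ 2 ≤ form p p * form q q := by
  rcases eq_or_ne q 0 with rfl | hq0
  · simp
  have hqq := form_orth_pos a hq hq0
  have h := form_orth_nonneg a (p := form q q • p - form p q • q) (by simp [hp, hq])
  simp only [form_sub_left, form_sub_right, form_smul_left, form_smul_right,
    form_comm q p] at h
  have h' : 0 ≤ form q q * (form p p * form q q - form p q ^ 2) := by nlinarith
  nlinarith [nonneg_of_mul_nonneg_right h' hqq]

theorem form_neg (p q : H2) : form p.1 q.1 < 0 := by
  have hp := p.sq
  have hq := q.sq
  have h1 := p.pos
  have h2 := q.pos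
  have h : (p.1 0 * q.1 0 + p.1 1 * q.1 1) ^ 2 < (p.1 2 * q.1 2) ^ 2 := by
    rw [mul_pow, hp, hq]
    nlinarith [sq_nonneg (p.1 0 * q.1 1 - p.1 1 * q.1 0), sq_nonneg (p.1 0), sq_nonneg (p.1 1),
      sq_nonneg (q.1 0), sq_nonneg (q.1 1)]
  have := abs_lt_of_sq_lt_sq h (by positivity)
  simp only [form]
  linarith [le_abs_self (p.1 0 * q.1 0 + p.1 1 * q.1 1)]

theorem form_le_neg_one (p q : H2) : form p.1 q.1 ≤ -1 := by
  have h := form_orth_nonneg p (p := q.1 + form p.1 q.1 • p.1) (by simp)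
  simp only [form_add_left, form_add_right, form_smul_left, form_smul_right, form_self,
    form_comm q.1 p.1] at h
  nlinarith [form_neg p q]

theorem eq_of_form_eq_neg_one {p q : H2} (h : form p.1 q.1 = -1) : p = q := by
  have := form_orth_eq_zero p (p := q.1 - p.1) (by simp [h]) (by simp [h, form_comm q.1 p.1])
  exact Subtype.ext (sub_eq_zero.mp this).symm

theorem form_lt_neg_one {p q : H2} (h : p ≠ q) : form p.1 q.1 < -1 :=
  lt_of_le_of_ne (form_le_neg_one p q) fun h' => h (eq_of_form_eq_neg_one h')

/-- Since `form p q < -1`, the normalization `form x x = -1` gives `1 > (a + b) ^ 2`. This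
strictness excludes farthest points inside segments. -/
theorem add_lt_one_of_combination {x p q : H2} {a b : ℝ} (ha : 0 < a) (hb : 0 < b) (hpq : p ≠ q)
    (hx : x.1 = a • p.1 + b • q.1) : a + b < 1 := by
  have h := form_self x
  rw [hx] at h
  simp only [form_add_left, form_add_right, form_smul_left, form_smul_right, form_self,
    form_comm q.1 p.1] at h
  nlinarith [form_lt_neg_one hpq, mul_pos ha hb]

/-- Normalization of a positive combination of two points. -/
theorem exists_normalized (p q : H2) {a b : ℝ} (ha : 0 ≤ a) (hb : 0 ≤ b) (hab : 0 < a + b) :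
    ∃ (x : H2) (r : ℝ), 0 < r ∧ x.1 = r • (a • p.1 + b • q.1) := by
  set y := a • p.1 + b • q.1 with hy
  have h : form y y = -(a ^ 2 + b ^ 2 + 2 * a * b * (-form p.1 q.1)) := by
    rw [hy]
    simp only [form_add_left, form_add_right, form_smul_left, form_smul_right, form_self,
      form_comm q.1 p.1]
    ring
  have h0 : 0 < -form y y := by
    rw [h]
    nlinarith [form_le_neg_one p q, mul_nonneg ha hb, mul_pos hab hab]
  have h2 : 0 < y 2 := by
    have := p.pos
    have := q.pos
    simp only [hy, Pi.add_apply, Pi.smul_apply, smul_eq_mul]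
    rcases ha.eq_or_lt with rfl | ha'
    · have : 0 < b := by linarith
      positivity
    · positivity
  have hs : 0 < Real.sqrt (-form y y) := Real.sqrt_pos.mpr h0
  obtain ⟨x, hx⟩ := exists_point (y := (Real.sqrt (-form y y))⁻¹ • y) (by
    simp only [form_smul_left, form_smul_right]
    have := Real.mul_self_sqrt h0.le
    field_simp
    nlinarith) (by
    simp only [Pi.smul_apply, smul_eq_mul]
    positivity)
  exact ⟨x, _, inv_pos.mpr hs, hx⟩

/-! The length of space-like vectors. -/

/-- The Lorentz length of a space-like vector. -/
noncomputable def lnorm (u : Fin 3 → ℝ) : ℝ := Real.sqrt (form u u)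

theorem lnorm_nonneg (u : Fin 3 → ℝ) : 0 ≤ lnorm u := Real.sqrt_nonneg _

theorem lnorm_sq (a : H2) {u : Fin 3 → ℝ} (h : form a.1 u = 0) : lnorm u ^ 2 = form u u :=
  Real.sq_sqrt (form_orth_nonneg a h)

theorem lnorm_smul {r : ℝ} (hr : 0 ≤ r) (u : Fin 3 → ℝ) : lnorm (r • u) = r * lnorm u := by
  unfold lnorm
  rw [form_smul_left, form_smul_right, ← mul_assoc, Real.sqrt_mul (by positivity),
    Real.sqrt_mul_self hr]

/-- The triangle inequality in a Euclidean plane; it needs both vectors orthogonal to a common point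
and fails for space-like vectors in general. -/
theorem lnorm_add_le (a : H2) {p q : Fin 3 → ℝ} (hp : form a.1 p = 0) (hq : form a.1 q = 0) :
    lnorm (p + q) ≤ lnorm p + lnorm q := by
  have h1 := lnorm_sq a hp
  have h2 := lnorm_sq a hq
  have h3 := lnorm_sq a (u := p + q) (by simp [hp, hq])
  have h4 := form_orth_cauchy a hp hq
  rw [← h1, ← h2, ← mul_pow] at h4
  have h5 := abs_le_of_sq_le_sq h4 (mul_nonneg (lnorm_nonneg _) (lnorm_nonneg _))
  simp only [form_add_left, form_add_right, form_comm q p] at h3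
  refine abs_le_of_sq_le_sq' ?_ (add_nonneg (lnorm_nonneg _) (lnorm_nonneg _)) |>.2
  nlinarith [le_abs_self (form p q)]

/-- The directions in which the height of `x` is at least `c` form a convex cone. -/
theorem height_combination (a : H2) {c : ℝ} (hc : 0 ≤ c) {x p q : Fin 3 → ℝ}
    (hp : form a.1 p = 0) (hq : form a.1 q = 0)
    (h1 : c * lnorm p ≤ form x p) (h2 : c * lnorm q ≤ form x q)
    {s t : ℝ} (hs : 0 ≤ s) (ht : 0 ≤ t) :
    c * lnorm (s • p + t • q) ≤ form x (s • p + t • q) := by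
  have h := lnorm_add_le a (p := s • p) (q := t • q) (by simp [hp]) (by simp [hq])
  rw [lnorm_smul hs, lnorm_smul ht] at h
  simp only [form_add_right, form_smul_right]
  nlinarith [mul_le_mul_of_nonneg_left h hc, mul_le_mul_of_nonneg_left h1 hs,
    mul_le_mul_of_nonneg_left h2 ht]

/-- Splitting a planar cone along one of its directions. -/
theorem cone_split {p q w u : Fin 3 → ℝ} {s t s' t' : ℝ} (hs : 0 < s) (ht : 0 < t)
    (hs' : 0 ≤ s') (ht' : 0 ≤ t') (hw : w = s • p + t • q) (hu : u = s' • p + t' • q) :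
    (∃ k l : ℝ, 0 ≤ k ∧ 0 ≤ l ∧ u = k • p + l • w) ∨
      ∃ k l : ℝ, 0 ≤ k ∧ 0 ≤ l ∧ u = k • w + l • q := by
  rcases le_total (t' * s) (s' * t) with h | h
  · refine Or.inl ⟨(s' * t - t' * s) / t, t' / t, div_nonneg (sub_nonneg.mpr h) ht.le,
      div_nonneg ht' ht.le, ?_⟩
    rw [hu, hw]
    ext i
    simp only [Pi.add_apply, Pi.smul_apply, smul_eq_mul]
    field_simp
    ring
  · refine Or.inr ⟨s' / s, (t' * s - s' * t) / s, div_nonneg hs' hs.le,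
      div_nonneg (sub_nonneg.mpr h) hs.le, ?_⟩
    rw [hu, hw]
    ext i
    simp only [Pi.add_apply, Pi.smul_apply, smul_eq_mul]
    field_simp
    ring

/-- A pencil in which two points share the task of being high. -/
theorem height_of_split (a : H2) {c : ℝ} (hc : 0 ≤ c) {x y p q w u : Fin 3 → ℝ}
    (hp : form a.1 p = 0) (hq : form a.1 q = 0) {s t s' t' : ℝ} (hs : 0 < s) (ht : 0 < t)
    (hs' : 0 ≤ s') (ht' : 0 ≤ t') (hw : w = s • p + t • q) (hu : u = s' • p + t' • q)
    (hxp : c * lnorm p ≤ form x p) (hxw : c * lnorm w ≤ form x w)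
    (hyw : c * lnorm w ≤ form y w) (hyq : c * lnorm q ≤ form y q) :
    c * lnorm u ≤ form x u ∨ c * lnorm u ≤ form y u := by
  have haw : form a.1 w = 0 := by simp [hw, hp, hq]
  rcases cone_split hs ht hs' ht' hw hu with ⟨k, l, hk, hl, rfl⟩ | ⟨k, l, hk, hl, rfl⟩
  · exact Or.inl (height_combination a hc hp haw hxp hxw hk hl)
  · exact Or.inr (height_combination a hc haw hq hyw hyq hk hl)

/-- Near a direction in which `x` is higher than `c`, the point `x` stays higher than `c`. -/
theorem exists_intermediate (a : H2) {c : ℝ} (hc : 0 ≤ c) {x y p w : Fin 3 → ℝ}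
    (hp : form a.1 p = 0) (hw : form a.1 w = 0) (hx : c * lnorm p < form x p)
    (hyp : c * lnorm p ≤ form y p) (hyw : c * lnorm w < form y w) :
    ∃ k : ℝ, 0 < k ∧ c * lnorm (p + k • w) ≤ form x (p + k • w) ∧
      c * lnorm (p + k • w) < form y (p + k • w) := by
  have hd : 0 < 1 + |c * lnorm w - form x w| := by positivity
  -- Small enough that the surplus of `x` at `p` covers its possible deficit along `k • w`; the
  -- added `1` keeps the denominator positive.
  set k := (form x p - c * lnorm p) / (1 + |c * lnorm w - form x w|) with hk
  have hk0 : 0 < k := div_pos (sub_pos.mpr hx) hd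
  have h1 : k * (1 + |c * lnorm w - form x w|) = form x p - c * lnorm p := by
    rw [hk]; field_simp
  have h2 := lnorm_add_le a (p := p) (q := k • w) hp (by simp [hw])
  rw [lnorm_smul hk0.le] at h2
  have h3 := mul_le_mul_of_nonneg_left h2 hc
  refine ⟨k, hk0, ?_, ?_⟩
  · simp only [form_add_right, form_smul_right]
    nlinarith [mul_le_mul_of_nonneg_left (le_abs_self (c * lnorm w - form x w)) hk0.le]
  · simp only [form_add_right, form_smul_right]
    nlinarith [mul_lt_mul_of_pos_left hyw hk0]

/-! ### Distances and projections -/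

theorem exists_point_of_form_neg {y : Fin 3 → ℝ} (v : H2) (h : form y y = -1)
    (hv : form y v.1 < 0) : ∃ p : H2, p.1 = y := by
  rcases lt_trichotomy (y 2) 0 with h2 | h2 | h2
  · obtain ⟨p, hp⟩ := exists_point (y := -y) (by simpa using h) (by simpa using h2)
    have := form_neg p v
    rw [hp, form_neg_left] at this
    linarith
  · simp only [form, h2] at h
    nlinarith [sq_nonneg (y 0), sq_nonneg (y 1)]
  · exact exists_point h h2

theorem hdist_le_hdist {p q r s : H2} :
    hdist p q ≤ hdist r s ↔ -form p.1 q.1 ≤ -form r.1 s.1 :=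
  Real.arcosh_le_arcosh (by linarith [form_neg p q]) (by linarith [form_neg r s])

theorem cosh_hdist (p q : H2) : Real.cosh (hdist p q) = -form p.1 q.1 :=
  Real.cosh_arcosh (by linarith [form_le_neg_one p q])

theorem hdist_nonneg (p q : H2) : 0 ≤ hdist p q :=
  Real.arcosh_nonneg (by linarith [form_le_neg_one p q])

theorem le_hdist {d : ℝ} (hd : 0 ≤ d) {p q : H2} : d ≤ hdist p q ↔ Real.cosh d ≤ -form p.1 q.1 := by
  rw [← cosh_hdist, Real.cosh_le_cosh, abs_of_nonneg hd, abs_of_nonneg (hdist_nonneg p q)]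

theorem distToSet_eq_of_isProjection {p q : H2} {L : Set H2} (h : IsProjection p L q) :
    distToSet p L = hdist p q := by
  refine IsLeast.csInf_eq ⟨⟨q, h.1, rfl⟩, ?_⟩
  rintro r ⟨x, hx, rfl⟩
  exact h.2 x hx

/-- The right-angled triangle formed by a point and its projection onto a line. -/
theorem foot_of_isProjection {A B v q : H2} (h : 0 < form v.1 (cross A.1 B.1))
    (hq : IsProjection v (lineThrough A B) q) :
    (∃ k : ℝ, v.1 = (-form v.1 q.1) • q.1 + k • cross A.1 B.1) ∧
      form v.1 (cross A.1 B.1) ^ 2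
        = (form v.1 q.1 ^ 2 - 1) * form (cross A.1 B.1) (cross A.1 B.1) := by
  set N := cross A.1 B.1 with hN
  have hN0 : N ≠ 0 := by rintro h0; rw [h0, form_zero_right] at h; exact h.false
  have hNN : 0 < form N N := form_orth_pos A (by rw [hN, form_cross_left]) hN0
  have hline : ∀ x ∈ lineThrough A B, form x.1 N = 0 := by
    rintro x ⟨a, b, hx⟩
    rw [hx, hN]; simp
  -- Up to the factor `form N N`, the component of `v` in the plane of the line; normalized by `ρ`
  -- it is the foot `f`.
  set y := form N N • v.1 - form v.1 N • N with hy
  have hyv : form y v.1 = -(form N N + form v.1 N ^ 2) := by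
    simp only [hy, form_sub_left, form_smul_left, form_self, form_comm N v.1]; ring
  have hyy : form y y = -(form N N * (form N N + form v.1 N ^ 2)) := by
    simp only [hy, form_sub_left, form_sub_right, form_smul_left, form_smul_right, form_self,
      form_comm N v.1]
    ring
  have hpos : 0 < form N N * (form N N + form v.1 N ^ 2) := by positivity
  set ρ := Real.sqrt (form N N * (form N N + form v.1 N ^ 2)) with hρ
  have hρ0 : 0 < ρ := Real.sqrt_pos.mpr hpos
  have hρ2 : ρ ^ 2 = form N N * (form N N + form v.1 N ^ 2) := Real.sq_sqrt hpos.le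
  obtain ⟨f, hf⟩ := exists_point_of_form_neg (y := ρ⁻¹ • y) v (by
    simp only [form_smul_left, form_smul_right, hyy, ← hρ2]
    field_simp) (by
    simp only [form_smul_left, hyv]
    have : 0 < ρ⁻¹ * (form N N + form v.1 N ^ 2) := by positivity
    linarith)
  have hyf : y = ρ • f.1 := by rw [hf, smul_smul, mul_inv_cancel₀ hρ0.ne', one_smul]
  have hmin : ∀ x ∈ lineThrough A B, form N N * form v.1 x.1 = ρ * form f.1 x.1 := by
    intro x hx
    have h1 : form y x.1 = form N N * form v.1 x.1 := by
      simp only [hy, form_sub_left, form_smul_left, form_comm N x.1, hline x hx]; ring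
    rw [← h1, hyf, form_smul_left]
  have hfl : f ∈ lineThrough A B := by
    have h1 := normal_expansion A.1 B.1 v.1
    rw [← hN] at h1
    refine ⟨ρ⁻¹ * (form A.1 B.1 * form v.1 B.1 - form B.1 B.1 * form v.1 A.1),
      ρ⁻¹ * (form A.1 B.1 * form v.1 A.1 - form A.1 A.1 * form v.1 B.1), ?_⟩
    rw [hf, hy, h1]
    ext i
    simp only [Pi.add_apply, Pi.sub_apply, Pi.smul_apply, smul_eq_mul]
    ring
  -- On the line, `form v` is a positive multiple of `form f`. So minimality at `q` forces `form f q
  -- ≥ -1`, that is, `f = q`.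
  have hqf : f = q := by
    apply eq_of_form_eq_neg_one
    refine le_antisymm (form_le_neg_one f q) ?_
    have h1 := hdist_le_hdist.mp (hq.2 f hfl)
    have h2 := hmin f hfl
    have h3 := hmin q hq.1
    rw [form_self] at h2
    have : ρ * (-1) ≤ ρ * form f.1 q.1 := by
      rw [← h2, ← h3]
      exact mul_le_mul_of_nonneg_left (by linarith) hNN.le
    exact le_of_mul_le_mul_left this hρ0
  have hvq : form N N * form v.1 q.1 = -ρ := by
    have := hmin f hfl
    rw [form_self, hqf] at this
    linarith
  refine ⟨⟨form v.1 N / form N N, ?_⟩, ?_⟩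
  · have h1 : form N N • v.1 = ρ • q.1 + form v.1 N • N := by
      rw [← hqf, ← hyf, hy]; abel
    have h2 : -form v.1 q.1 = ρ / form N N := by field_simp; linarith
    rw [h2]
    ext i
    have := congrFun h1 i
    simp only [Pi.add_apply, Pi.smul_apply, smul_eq_mul] at this ⊢
    field_simp
    linarith
  · have h1 : (form N N * form v.1 q.1) ^ 2 = ρ ^ 2 := by rw [hvq]; ring
    rw [hρ2] at h1
    have : form N N * form v.1 N ^ 2 = form N N * ((form v.1 q.1 ^ 2 - 1) * form N N) := by
      nlinarith
    exact mul_left_cancel₀ hNN.ne' this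

/-! ### Side normals, axes and acute angles of the polygon -/

/-- The tangent vector at `p` pointing to `x`. -/
def tangent (p x : H2) : Fin 3 → ℝ := x.1 + form p.1 x.1 • p.1

@[simp] theorem form_tangent_base (p x : H2) : form (tangent p x) p.1 = 0 := by
  simp [tangent, form_comm x.1 p.1]

theorem form_tangent_target {p x : H2} (hne : p ≠ x) : 0 < form (tangent p x) x.1 := by
  have := form_lt_neg_one hne
  simp only [tangent, form_add_left, form_smul_left, form_self]
  nlinarith

/-- The (unnormalized) inward normal of the side from `v i` to `v (i + 1)`. -/
def sideNormal {n : ℕ} (v : ZMod n → H2) (i : ZMod n) : Fin 3 → ℝ :=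
  cross (v i).1 (v (i + 1)).1

/-- The metric data of an ordinary reduced polygon: all vertices `v i` have the same distance
(of hyperbolic sine `c` and hyperbolic cosine `C`) from the opposite sides, and project onto
points `q i` of these sides. -/
structure IsStarPolygon {n : ℕ} (m : ℕ) (v q : ZMod n → H2) (c C : ℝ) : Prop where
  card_eq : n = 2 * m + 1
  one_le : 1 ≤ m
  c_pos : 0 < c
  C_pos : 0 < C
  sq_eq : C ^ 2 = 1 + c ^ 2
  orient : ∀ i j, j ≠ i → j ≠ i + 1 → 0 < form (v j).1 (sideNormal v i)
  foot_mem : ∀ i, ∃ a b : ℝ, 0 < a ∧ 0 < b ∧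
    (q i).1 = a • (v (i + m)).1 + b • (v (i + m + 1)).1
  foot : ∀ i, ∃ k : ℝ, (v i).1 = C • (q i).1 + k • sideNormal v (i + m)
  height : ∀ i, form (v i).1 (sideNormal v (i + m)) = c * lnorm (sideNormal v (i + m))

namespace IsStarPolygon

variable {n m : ℕ} {v q : ZMod n → H2} {c C : ℝ}

theorem natCast_ne (_h : IsStarPolygon m v q c C) {a b : ℕ} (ha : a < n) (hb : b < n)
    (hab : a ≠ b) : (a : ZMod n) ≠ b := by
  intro h'
  rw [ZMod.natCast_eq_natCast_iff', Nat.mod_eq_of_lt ha, Nat.mod_eq_of_lt hb] at h'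
  exact hab h'

theorem m_add (h : IsStarPolygon m v q c C) : (m : ZMod n) + m + 1 = 0 := by
  have h1 : ((2 * m + 1 : ℕ) : ZMod n) = 0 := by rw [← h.card_eq, ZMod.natCast_self]
  push_cast at h1
  linear_combination h1

theorem m_ne (h : IsStarPolygon m v q c C) : (m : ZMod n) ≠ 0 := by
  have h1 := h.one_le
  have h2 := h.card_eq
  simpa using h.natCast_ne (a := m) (b := 0) (by omega) (by omega) (by omega)

theorem m_succ_ne (h : IsStarPolygon m v q c C) : (m : ZMod n) + 1 ≠ 0 := by
  intro h'
  apply h.m_ne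
  linear_combination h.m_add - h'

theorem one_ne (h : IsStarPolygon m v q c C) : (1 : ZMod n) ≠ 0 := by
  have h1 := h.one_le
  have h2 := h.card_eq
  simpa using h.natCast_ne (a := 1) (b := 0) (by omega) (by omega) (by omega)

theorem two_ne (h : IsStarPolygon m v q c C) : (1 : ZMod n) + 1 ≠ 0 := by
  have h1 := h.one_le
  have h2 := h.card_eq
  have := h.natCast_ne (a := 2) (b := 0) (by omega) (by omega) (by omega)
  intro h'
  apply this
  push_cast
  linear_combination h'

theorem orient_nonneg (h : IsStarPolygon m v q c C) (i j : ZMod n) :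
    0 ≤ form (v j).1 (sideNormal v i) := by
  by_cases h1 : j = i
  · rw [h1, sideNormal, form_cross_left]
  by_cases h2 : j = i + 1
  · rw [h2, sideNormal, form_cross_right]
  exact (h.orient i j h1 h2).le

/-- The angle at a vertex, as the orientation of the vertex and its two neighbours. -/
theorem orient_corner (h : IsStarPolygon m v q c C) (i : ZMod n) :
    0 < form (v (i + 1)).1 (cross (v (i - 1)).1 (v i).1) := by
  have := h.orient (i - 1) (i + 1) (fun e => h.two_ne (by linear_combination e))
    (fun e => h.one_ne (by linear_combination e))
  rwa [sideNormal, sub_add_cancel] at this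

theorem sideNormal_pred (v : ZMod n → H2) (i : ZMod n) :
    sideNormal v (i - 1) = cross (v (i - 1)).1 (v i).1 := by
  rw [sideNormal, sub_add_cancel]

/-- Support directions at a vertex are nonnegative combinations of the normals of the two sides. -/
theorem pencil (h : IsStarPolygon m v q c C) (i : ZMod n) {u : Fin 3 → ℝ}
    (hu : form (v i).1 u = 0) :
    u = (form (v (i + 1)).1 u / form (v (i + 1)).1 (sideNormal v (i - 1))) • sideNormal v (i - 1)
      + (form (v (i - 1)).1 u / form (v (i + 1)).1 (sideNormal v (i - 1))) • sideNormal v i := by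
  have h1 := dual_expansion (v (i - 1)).1 (v i).1 (v (i + 1)).1 u
  have h2 := h.orient_corner i
  rw [form_comm u (v i).1, hu, zero_smul, add_zero] at h1
  rw [sideNormal_pred, sideNormal]
  ext k
  have := congrFun h1 k
  simp only [Pi.add_apply, Pi.smul_apply, smul_eq_mul, form_comm u] at this ⊢
  field_simp
  linarith

theorem vertex_sideNormal (v : ZMod n → H2) (i : ZMod n) :
    form (v i).1 (sideNormal v i) = 0 := form_cross_left _ _

theorem vertex_sideNormal_pred (v : ZMod n → H2) (i : ZMod n) :
    form (v i).1 (sideNormal v (i - 1)) = 0 := by rw [sideNormal_pred, form_cross_right]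

theorem vertex_succ_sideNormal (v : ZMod n → H2) (i : ZMod n) :
    form (v (i + 1)).1 (sideNormal v i) = 0 := form_cross_right _ _

theorem ne_of_ne (h : IsStarPolygon m v q c C) {i j : ZMod n} (hij : i ≠ j) : v i ≠ v j := by
  intro e
  by_cases h1 : j = i + 1
  · have := h.orient (i - 1) j (fun e => h.two_ne (by rw [h1] at e; linear_combination e))
      (fun e => hij (by rw [e]; ring))
    rw [← e, vertex_sideNormal_pred] at this
    exact this.false
  · have := h.orient i j (Ne.symm hij) h1
    rw [← e, vertex_sideNormal] at this
    exact this.false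

/-- The tangent vector at `v i` pointing to the projection of `v i` onto the opposite side. -/
def axis (v q : ZMod n → H2) (C : ℝ) (i : ZMod n) : Fin 3 → ℝ := (q i).1 - C • (v i).1

/-- The hyperbolic theorem of Pythagoras: the normal component of `v i` is invisible to vectors in
the plane of the opposite side. -/
theorem form_foot (h : IsStarPolygon m v q c C) (i : ZMod n) {x : Fin 3 → ℝ}
    (hx : form x (sideNormal v (i + m)) = 0) : form x (v i).1 = C * form x (q i).1 := by
  obtain ⟨k, hk⟩ := h.foot i
  rw [hk, form_add_right, form_smul_right, form_smul_right, hx]; ring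

theorem foot_sideNormal (h : IsStarPolygon m v q c C) (i : ZMod n) :
    form (q i).1 (sideNormal v (i + m)) = 0 := by
  obtain ⟨a, b, -, -, hq⟩ := h.foot_mem i
  rw [hq, form_add_left, form_smul_left, form_smul_left, vertex_sideNormal,
    vertex_succ_sideNormal]
  ring

theorem form_vertex_foot (h : IsStarPolygon m v q c C) (i : ZMod n) :
    form (v i).1 (q i).1 = -C := by
  have := h.form_foot i (h.foot_sideNormal i)
  rw [form_self] at this
  rw [form_comm, this]; ring

theorem vertex_axis (h : IsStarPolygon m v q c C) (i : ZMod n) :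
    form (v i).1 (axis v q C i) = 0 := by
  simp only [axis, form_sub_right, form_smul_right, form_self, h.form_vertex_foot]; ring

theorem form_axis_self (h : IsStarPolygon m v q c C) (i : ZMod n) :
    form (axis v q C i) (axis v q C i) = c ^ 2 := by
  simp only [axis, form_sub_left, form_sub_right, form_smul_left, form_smul_right, form_self,
    form_comm (q i).1 (v i).1, h.form_vertex_foot]
  nlinarith [h.sq_eq]

theorem lnorm_axis (h : IsStarPolygon m v q c C) (i : ZMod n) : lnorm (axis v q C i) = c := by
  rw [lnorm, h.form_axis_self, Real.sqrt_sq h.c_pos.le]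

theorem foot_ne (h : IsStarPolygon m v q c C) (i : ZMod n) :
    v (i + m) ≠ q i ∧ v (i + m + 1) ≠ q i := by
  obtain ⟨a, b, ha, hb, hq⟩ := h.foot_mem i
  have hAB : v (i + m) ≠ v (i + m + 1) := h.ne_of_ne fun e => h.one_ne (by linear_combination -e)
  have hg := form_lt_neg_one hAB
  set g := form (v (i + m)).1 (v (i + m + 1)).1 with hgdef
  have h1 : form (v (i + m)).1 (q i).1 = a * (-1) + b * g := by rw [hq]; simp [hgdef]
  have h2 : form (v (i + m + 1)).1 (q i).1 = a * g + b * (-1) := by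
    rw [hq]; simp [hgdef, form_comm]
  have hg2 : 0 < g ^ 2 - 1 := by nlinarith
  constructor
  · intro e
    rw [← e, form_self] at h1
    rw [← e, form_comm, ← hgdef] at h2
    have : b * (g ^ 2 - 1) = 0 := by linear_combination -g * h1 - h2
    exact (mul_pos hb hg2).ne' this
  · intro e
    rw [← e, form_self] at h2
    rw [← e, ← hgdef] at h1
    have : a * (g ^ 2 - 1) = 0 := by linear_combination -g * h2 - h1
    exact (mul_pos ha hg2).ne' this

/-- The line at `v i` orthogonal to the axis and the line of the opposite side have the common
perpendicular from `v i` to `q i`, so `q i` is the only nearest point. The strictness leaves room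
for the cut. -/
theorem axis_height (h : IsStarPolygon m v q c C) (i : ZMod n) {x : H2}
    (hx : form x.1 (sideNormal v (i + m)) = 0) (hne : x ≠ q i) :
    c * lnorm (axis v q C i) < form x.1 (axis v q C i) := by
  have h1 := form_lt_neg_one hne
  have h2 := h.sq_eq
  have h3 := h.c_pos
  rw [h.lnorm_axis, axis, form_sub_right, form_smul_right, h.form_foot i hx]
  nlinarith [mul_pos h3 h3]

theorem axis_height_left (h : IsStarPolygon m v q c C) (i : ZMod n) :
    c * lnorm (axis v q C i) < form (v (i + m)).1 (axis v q C i) :=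
  h.axis_height i (vertex_sideNormal _ _) (h.foot_ne i).1

theorem axis_height_right (h : IsStarPolygon m v q c C) (i : ZMod n) :
    c * lnorm (axis v q C i) < form (v (i + m + 1)).1 (axis v q C i) :=
  h.axis_height i (vertex_succ_sideNormal _ _) (h.foot_ne i).2

theorem add_m_add_m (h : IsStarPolygon m v q c C) (i : ZMod n) : i + m + m = i - 1 := by
  linear_combination h.m_add

theorem add_m_succ_add_m (h : IsStarPolygon m v q c C) (i : ZMod n) : i + m + 1 + m = i := by
  linear_combination h.m_add

theorem height_left (h : IsStarPolygon m v q c C) (i : ZMod n) :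
    form (v (i + m)).1 (sideNormal v (i - 1)) = c * lnorm (sideNormal v (i - 1)) := by
  have := h.height (i + m)
  rwa [h.add_m_add_m] at this

theorem height_right (h : IsStarPolygon m v q c C) (i : ZMod n) :
    form (v (i + m + 1)).1 (sideNormal v i) = c * lnorm (sideNormal v i) := by
  have := h.height (i + m + 1)
  rwa [h.add_m_succ_add_m] at this

/-- The projection of `v (i + m)` onto the side before `v i` lies on the side of `v (i - 1)`. -/
theorem tangent_left (h : IsStarPolygon m v q c C) (i : ZMod n) :
    0 < form (tangent (v i) (v (i - 1))) (v (i + m)).1 := by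
  have hne : v i ≠ v (i - 1) := h.ne_of_ne fun e => h.one_ne (by linear_combination e)
  obtain ⟨a, b, ha, -, hq⟩ := h.foot_mem (i + m)
  rw [h.add_m_add_m, sub_add_cancel] at hq
  rw [h.form_foot (i + m), hq, form_add_right, form_smul_right, form_smul_right,
    form_tangent_base]
  · have := form_tangent_target hne
    have := h.C_pos
    rw [mul_zero, add_zero]
    positivity
  · rw [h.add_m_add_m, tangent, form_add_left, form_smul_left, vertex_sideNormal,
      vertex_sideNormal_pred]
    ring

/-- The projection of `v (i + m + 1)` onto the side after `v i` lies on the side of `v (i + 1)`. -/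
theorem tangent_right (h : IsStarPolygon m v q c C) (i : ZMod n) :
    0 < form (tangent (v i) (v (i + 1))) (v (i + m + 1)).1 := by
  have hne : v i ≠ v (i + 1) := h.ne_of_ne fun e => h.one_ne (by linear_combination -e)
  obtain ⟨a, b, -, hb, hq⟩ := h.foot_mem (i + m + 1)
  rw [h.add_m_succ_add_m] at hq
  rw [h.form_foot (i + m + 1), hq, form_add_right, form_smul_right, form_smul_right,
    form_tangent_base]
  · have := form_tangent_target hne
    have := h.C_pos
    rw [mul_zero, zero_add]
    positivity
  · rw [h.add_m_succ_add_m, tangent, form_add_left, form_smul_left, vertex_sideNormal,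
      vertex_succ_sideNormal]
    ring

theorem orient_opposite (h : IsStarPolygon m v q c C) (i : ZMod n) :
    0 < form (v (i + m + 1)).1 (cross (v i).1 (v (i + m)).1) := by
  have := h.orient (i + m) i (fun e => h.m_ne (by linear_combination -e))
    (fun e => h.m_succ_ne (by linear_combination -e))
  rwa [sideNormal, form_cross_rotate, form_cross_rotate] at this

/-- The angle at `v i` between `v (i - 1)` and the foot is acute. The tangent towards `v (i - 1)` is
positive at `v (i + m)`; `four_vectors` and the orientation carry this to `v (i + m + 1)`, and the
foot lies between the two. With `axis_next`, the line orthogonal to the axis touches the polygon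
only at `v i`. -/
theorem axis_prev (h : IsStarPolygon m v q c C) (i : ZMod n) :
    0 < form (v (i - 1)).1 (axis v q C i) := by
  have hne : v i ≠ v (i - 1) := h.ne_of_ne fun e => h.one_ne (by linear_combination e)
  have hA := h.tangent_left i
  have hz := form_tangent_target hne
  have hAB := h.orient_opposite i
  have hzA : 0 < form (v (i + m)).1 (sideNormal v (i - 1)) :=
    h.orient _ _ (fun e => h.m_succ_ne (by linear_combination e))
      (fun e => h.m_ne (by linear_combination e))
  -- Only nonnegative: for `m = 1` this vertex is `v (i - 1)` itself.
  have hzB := h.orient_nonneg (i - 1) (i + m + 1)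
  rw [sideNormal_pred] at hzA hzB
  have h4 := four_vectors (v i).1 (v (i - 1)).1 (v (i + m)).1 (v (i + m + 1)).1
    (tangent (v i) (v (i - 1)))
  rw [form_tangent_base, form_cross_swap (v i).1 (v (i - 1)).1,
    form_cross_swap (v i).1 (v (i - 1)).1] at h4
  have hB : 0 < form (tangent (v i) (v (i - 1))) (v (i + m + 1)).1 := by
    by_contra! hB
    nlinarith [mul_pos hAB hz, mul_nonneg hzB hA.le]
  obtain ⟨a, b, ha, hb, hq⟩ := h.foot_mem i
  have hx : form (v (i - 1)).1 (axis v q C i) = form (tangent (v i) (v (i - 1))) (q i).1 := by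
    simp only [axis, tangent, form_sub_right, form_add_left, form_smul_left, form_smul_right,
      h.form_vertex_foot, form_comm (v (i - 1)).1 (v i).1]
    ring
  rw [hx, hq, form_add_right, form_smul_right, form_smul_right]
  positivity

theorem axis_next (h : IsStarPolygon m v q c C) (i : ZMod n) :
    0 < form (v (i + 1)).1 (axis v q C i) := by
  have hne : v i ≠ v (i + 1) := h.ne_of_ne fun e => h.one_ne (by linear_combination -e)
  have hB := h.tangent_right i
  have hz := form_tangent_target hne
  have hAB := h.orient_opposite i
  have hzB : 0 < form (v (i + m + 1)).1 (sideNormal v i) :=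
    h.orient _ _ (fun e => h.m_succ_ne (by linear_combination e))
      (fun e => h.m_ne (by linear_combination e))
  have hzA := h.orient_nonneg i (i + m)
  rw [sideNormal] at hzA hzB
  have h4 := four_vectors (v i).1 (v (i + 1)).1 (v (i + m)).1 (v (i + m + 1)).1
    (tangent (v i) (v (i + 1)))
  rw [form_tangent_base] at h4
  have hA : 0 < form (tangent (v i) (v (i + 1))) (v (i + m)).1 := by
    by_contra! hA
    nlinarith [mul_pos hAB hz, mul_nonneg hzA hB.le]
  obtain ⟨a, b, ha, hb, hq⟩ := h.foot_mem i
  have hx : form (v (i + 1)).1 (axis v q C i) = form (tangent (v i) (v (i + 1))) (q i).1 := by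
    simp only [axis, tangent, form_sub_right, form_add_left, form_smul_left, form_smul_right,
      h.form_vertex_foot, form_comm (v (i + 1)).1 (v i).1]
    ring
  rw [hx, hq, form_add_right, form_smul_right, form_smul_right]
  positivity

end IsStarPolygon

/-! Convex sets. -/

theorem eq_of_smul {x p : H2} {b : ℝ} (hb : 0 ≤ b) (h : x.1 = b • p.1) : x = p := by
  have h1 := form_self x
  rw [h, form_smul_left, form_smul_right, form_self] at h1
  have h2 : b = 1 := by nlinarith
  exact Subtype.ext (by rw [h, h2, one_smul])

theorem hull_subset {S K : Set H2} (hK : IsConvex K) (hS : S ⊆ K) : hull S ⊆ K :=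
  Set.sInter_subset_of_mem ⟨hK, hS⟩

theorem subset_hull (S : Set H2) : S ⊆ hull S :=
  Set.subset_sInter fun _ h => h.2

theorem isConvex_halfPlane (u : Fin 3 → ℝ) : IsConvex {x : H2 | 0 ≤ form x.1 u} := by
  rintro p hp q hq x ⟨a, b, ha, hb, hx⟩
  simp only [Set.mem_ofPred_eq] at hp hq ⊢
  rw [hx, form_add_left, form_smul_left, form_smul_left]
  positivity

/-- An open half-plane together with one boundary point is convex. -/
theorem isConvex_halfPlane_insert {u : Fin 3 → ℝ} {p : H2} (hp : form p.1 u = 0) :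
    IsConvex {x : H2 | 0 < form x.1 u ∨ x = p} := by
  rintro x hx y hy z ⟨a, b, ha, hb, hz⟩
  simp only [Set.mem_ofPred_eq] at hx hy ⊢
  have hzu : form z.1 u = a * form x.1 u + b * form y.1 u := by
    rw [hz, form_add_left, form_smul_left, form_smul_left]
  rcases ha.eq_or_lt with rfl | ha'
  · have : z = y := eq_of_smul hb (by simpa using hz)
    exact this ▸ hy
  rcases hb.eq_or_lt with rfl | hb'
  · have : z = x := eq_of_smul ha (by simpa using hz)
    exact this ▸ hx
  rcases hx with hx | rfl
  · rcases hy with hy | rfl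
    · left; rw [hzu]; positivity
    · left; rw [hzu, hp]; nlinarith [mul_pos ha' hx]
  · rcases hy with hy | rfl
    · left; rw [hzu, hp]; nlinarith [mul_pos hb' hy]
    · right
      exact eq_of_smul (b := a + b) (by positivity) (by rw [hz, add_smul])

theorem isConvex_openHalfPlane (u : Fin 3 → ℝ) : IsConvex {x : H2 | 0 < form x.1 u} := by
  rintro p hp q hq x ⟨a, b, ha, hb, hx⟩
  simp only [Set.mem_ofPred_eq] at hp hq ⊢
  have h1 : form x.1 u = a * form p.1 u + b * form q.1 u := by
    rw [hx, form_add_left, form_smul_left, form_smul_left]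
  rcases ha.eq_or_lt with rfl | ha'
  · have : x = q := eq_of_smul hb (by simpa using hx)
    exact this ▸ hq
  · rw [h1]; positivity

theorem IsConvex.inter {K M : Set H2} (hK : IsConvex K) (hM : IsConvex M) : IsConvex (K ∩ M) :=
  fun p hp q hq _ hx => ⟨hK p hp.1 q hq.1 hx, hM p hp.2 q hq.2 hx⟩

theorem continuous_form_right (u : Fin 3 → ℝ) : Continuous fun x : H2 => form x.1 u :=
  continuous_form.comp (continuous_subtype_val.prodMk continuous_const)

theorem continuous_form_points : Continuous fun x : H2 × H2 => form x.1.1 x.2.1 :=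
  continuous_form.comp ((continuous_subtype_val.comp continuous_fst).prodMk
    (continuous_subtype_val.comp continuous_snd))

/-- On the segment from `p` to `x` there are points arbitrarily close to `p`. -/
theorem exists_near (p x : H2) {P : (Fin 3 → ℝ) → Prop} (hP : ∀ᶠ z in 𝓝 p.1, P z) :
    ∃ (y : H2) (a b : ℝ), 0 < a ∧ 0 < b ∧ y.1 = a • p.1 + b • x.1 ∧ P y.1 := by
  let f : ℝ → Fin 3 → ℝ := fun k =>
    (Real.sqrt (1 + k ^ 2 + 2 * k * (-form p.1 x.1)))⁻¹ • (p.1 + k • x.1)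
  have hf0 : f 0 = p.1 := by simp [f]
  have hf : ContinuousAt f 0 := by
    have h1 : ContinuousAt (fun k : ℝ => Real.sqrt (1 + k ^ 2 + 2 * k * (-form p.1 x.1))) 0 := by
      fun_prop
    have h2 : ContinuousAt (fun k : ℝ => p.1 + k • x.1) 0 := by fun_prop
    exact (h1.inv₀ (by simp)).smul h2
  have h1 : ∀ᶠ k in 𝓝 (0 : ℝ), P (f k) := by
    have : Tendsto f (𝓝 0) (𝓝 p.1) := by rw [← hf0]; exact hf
    exact this.eventually hP
  obtain ⟨k, hk, hk0⟩ :=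
    ((h1.filter_mono nhdsWithin_le_nhds).and (self_mem_nhdsWithin (s := Set.Ioi 0))).exists
  have hk0 : 0 < k := hk0
  have hg := form_neg p x
  have hD : 0 < 1 + k ^ 2 + 2 * k * (-form p.1 x.1) := by
    have : 0 < k * (-form p.1 x.1) := mul_pos hk0 (by linarith)
    nlinarith
  have hs := Real.sqrt_pos.mpr hD
  obtain ⟨y, hy⟩ := exists_point (y := f k) (by
    have h2 : form (p.1 + k • x.1) (p.1 + k • x.1)
        = -Real.sqrt (1 + k ^ 2 + 2 * k * (-form p.1 x.1)) ^ 2 := by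
      rw [Real.sq_sqrt hD.le]
      simp only [form_smul_left, form_smul_right, form_add_left, form_add_right, form_self,
        form_comm x.1 p.1]
      ring
    simp only [f]
    rw [form_smul_left, form_smul_right, h2]
    generalize Real.sqrt (1 + k ^ 2 + 2 * k * (-form p.1 x.1)) = S at hs ⊢
    field_simp) (by
    have := p.pos
    have := x.pos
    simp only [f, Pi.smul_apply, Pi.add_apply, smul_eq_mul]
    positivity)
  refine ⟨y, (Real.sqrt (1 + k ^ 2 + 2 * k * (-form p.1 x.1)))⁻¹,
    (Real.sqrt (1 + k ^ 2 + 2 * k * (-form p.1 x.1)))⁻¹ * k, by positivity, by positivity, ?_, ?_⟩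
  · rw [hy]
    simp only [f, smul_add, smul_smul]
  · rwa [hy]

/-! Widths. -/

theorem sq_form_ge {x y : H2} {u : Fin 3 → ℝ} (hu : form u u = 1) (hx : form x.1 u = 0) :
    1 + form y.1 u ^ 2 ≤ form x.1 y.1 ^ 2 := by
  have h := form_orth_nonneg x (p := y.1 + form x.1 y.1 • x.1 - form y.1 u • u) (by simp [hx])
  simp only [form_add_left, form_add_right, form_sub_left, form_sub_right, form_smul_left,
    form_smul_right, form_self, form_comm y.1 x.1, form_comm u x.1, form_comm u y.1, hu, hx] at h
  nlinarith

theorem exists_form_bound {Z : Set H2} (hZ : IsCompact Z) :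
    ∃ K : ℝ, ∀ x ∈ Z, ∀ y ∈ Z, hdist x y ≤ Real.arcosh K := by
  obtain ⟨K, hK⟩ := (hZ.prod hZ).bddAbove_image
    (f := fun x : H2 × H2 => -form x.1.1 x.2.1) continuous_form_points.neg.continuousOn
  refine ⟨K, fun x hx y hy => ?_⟩
  have h : -form x.1 y.1 ≤ K := hK ⟨(x, y), ⟨hx, hy⟩, rfl⟩
  have := form_neg x y
  exact (Real.arcosh_le_arcosh (by linarith) (by linarith)).mpr h

theorem setDist_le {S T : Set H2} {x y : H2} (hx : x ∈ S) (hy : y ∈ T) :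
    setDist S T ≤ hdist x y := by
  refine csInf_le ⟨0, ?_⟩ ⟨x, hx, y, hy, rfl⟩
  rintro r ⟨x, -, y, -, rfl⟩
  exact hdist_nonneg x y

/-- If some point of `Z` has distance at least `d` from the supporting line `L`, then the width
of `Z` determined by `L` is at least `d`. -/
theorem le_width {Z L : Set H2} {u : Fin 3 → ℝ} {d : ℝ} (hZ : IsCompact Z) (hd : 0 < d)
    (hL : IsLineWithNormal L u) (hLZ : (L ∩ Z).Nonempty)
    {z₀ : H2} (hz₀ : z₀ ∈ Z) (hz : Real.sinh d ≤ form z₀.1 u) : d ≤ width L Z := by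
  obtain ⟨z, hzZ, hmax⟩ := hZ.exists_isMaxOn ⟨z₀, hz₀⟩ (continuous_form_right u).continuousOn
  have hmax : ∀ x ∈ Z, form x.1 u ≤ form z.1 u := hmax
  set k := form z.1 u with hk
  have hdk : Real.sinh d ≤ k := hz.trans (hmax _ hz₀)
  have hs : 0 < Real.sinh d := Real.sinh_pos_iff.mpr hd
  have hk0 : 0 < k := hs.trans_le hdk
  obtain ⟨huu, hLeq⟩ := hL
  set ρ := Real.sqrt (1 + k ^ 2) with hρ
  have hρ2 : ρ ^ 2 = 1 + k ^ 2 := Real.sq_sqrt (by positivity)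
  have hρ1 : 1 < ρ := by
    rw [hρ, Real.lt_sqrt one_pos.le]
    nlinarith
  -- `u + k • z` is the component of `u` orthogonal to `z`: it is normal to the line through `z`
  -- perpendicular to the perpendicular from `z` to `L`. The sign puts `Z` on the nonnegative side.
  set w : Fin 3 → ℝ := -(ρ⁻¹ • (u + k • z.1)) with hw
  have hform : ∀ x : H2, form x.1 w = -(ρ⁻¹ * (form x.1 u + k * form x.1 z.1)) := by
    intro x; simp [hw]; ring
  have hww : form w w = 1 := by
    have : form w w = ρ⁻¹ * ρ⁻¹ * (1 + k ^ 2) := by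
      simp only [hw, form_neg_left, form_neg_right, form_smul_left, form_smul_right,
        form_add_left, form_add_right, form_self, huu, form_comm u z.1, ← hk]
      ring
    rw [this, ← hρ2]
    field_simp
  let M : Set H2 := {x : H2 | form x.1 w = 0}
  have hzM : z ∈ M := by
    change form z.1 w = 0
    rw [hform, form_self]; ring
  have hMZ : Supports M Z := by
    refine ⟨⟨z, hzM, hzZ⟩, w, ⟨hww, rfl⟩, fun x hx => ?_⟩
    rw [hform]
    have h1 := hmax x hx
    have h2 := form_le_neg_one x z
    have h3 : form x.1 u + k * form x.1 z.1 ≤ 0 := by nlinarith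
    have h4 : 0 ≤ ρ⁻¹ * (-(form x.1 u + k * form x.1 z.1)) :=
      mul_nonneg (by positivity) (by linarith)
    linarith
  have hLM : Ultraparallel L M := by
    refine ⟨u, w, ⟨huu, hLeq⟩, ⟨hww, rfl⟩, ?_⟩
    have : form u w = -ρ := by
      have : form u w = -(ρ⁻¹ * (1 + k ^ 2)) := by
        simp only [hw, form_neg_right, form_smul_right, form_add_right, huu, form_comm u z.1, ← hk]
        ring
      rw [this, ← hρ2]
      field_simp
    rw [this, abs_neg, abs_of_pos (by linarith)]
    exact hρ1
  have hdist : d ≤ setDist L M := by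
    obtain ⟨l, hl, -⟩ := hLZ
    refine le_csInf ⟨_, l, hl, z, hzM, rfl⟩ ?_
    rintro r ⟨x, hx, y, hy, rfl⟩
    rw [le_hdist hd.le]
    rw [hLeq] at hx
    have hx : form x.1 u = 0 := hx
    have hy : form y.1 w = 0 := hy
    rw [hform, neg_eq_zero] at hy
    have hy' : form y.1 u = -(k * form y.1 z.1) := by
      have := (mul_eq_zero.mp hy).resolve_left (by positivity)
      linarith
    have h1 : k ≤ form y.1 u := by
      rw [hy']; nlinarith [form_le_neg_one y z]
    have h2 := sq_form_ge (y := y) huu hx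
    have h3 := Real.cosh_sq d
    refine abs_le_of_sq_le_sq' ?_ (by linarith [form_neg x y]) |>.2
    nlinarith
  -- A real `sSup` is zero on unbounded sets, so a bound is required; two touching points in `Z`
  -- bound each distance of lines.
  refine hdist.trans (le_csSup ?_ ⟨M, hMZ, hLM, rfl⟩)
  obtain ⟨K, hK⟩ := exists_form_bound hZ
  obtain ⟨l, hl, hlZ⟩ := hLZ
  refine ⟨Real.arcosh K, ?_⟩
  rintro r ⟨M', ⟨⟨x, hxM, hxZ⟩, -⟩, -, rfl⟩
  exact (setDist_le hl hxM).trans (hK l hlZ x hxZ)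

/-- One high point per supporting direction suffices, by `le_width`. The assumption `hne` provides a
supporting line, because the real infimum of the empty set is zero. -/
theorem le_thickness {Z : Set H2} {d : ℝ} (hZ : IsCompact Z) (hd : 0 < d)
    (hne : ∃ u : Fin 3 → ℝ, 0 < form u u ∧ (∀ x ∈ Z, 0 ≤ form x.1 u) ∧ ∃ x ∈ Z, form x.1 u = 0)
    (h : ∀ u : Fin 3 → ℝ, form u u = 1 → (∀ x ∈ Z, 0 ≤ form x.1 u) → ∀ x ∈ Z, form x.1 u = 0 →
      ∃ z ∈ Z, Real.sinh d ≤ form z.1 u) : d ≤ thickness Z := by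
  refine le_csInf ?_ ?_
  · obtain ⟨u, hu, hZu, x, hxZ, hx⟩ := hne
    have hs := Real.sqrt_pos.mpr hu
    refine ⟨_, {x : H2 | form x.1 ((Real.sqrt (form u u))⁻¹ • u) = 0}, ⟨⟨x, ?_, hxZ⟩,
      (Real.sqrt (form u u))⁻¹ • u, ⟨?_, rfl⟩, fun y hy => ?_⟩, rfl⟩
    · simp [hx]
    · have := Real.mul_self_sqrt hu.le
      simp only [form_smul_left, form_smul_right]
      field_simp
      nlinarith
    · have := hZu y hy
      rw [form_smul_right]
      positivity
  · rintro r ⟨L, ⟨⟨x, hxL, hxZ⟩, u, hLu, hZu⟩, rfl⟩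
    have hx : form x.1 u = 0 := by
      have := hLu.2 ▸ hxL
      exact this
    obtain ⟨z, hzZ, hz⟩ := h u hLu.1 hZu x hxZ hx
    exact le_width hZ hd hLu ⟨x, hxL, hxZ⟩ hzZ hz

/-- Directions supporting at `a` an angle whose sides have the normals `p` and `w`. -/
theorem pencil_combination {y a z p w u : Fin 3 → ℝ} {k : ℝ} (hk : k ≠ 0)
    (hp : cross y a = k • p) (hzp : 0 < form z p) (haw : form a w = 0) (hzw : form z w = 0)
    (hyw : 0 < form y w) (hau : form a u = 0) :
    u = (form z u / form z p) • p + (form y u / form y w) • w := by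
  have hu := dual_expansion y a z u
  have hw := dual_expansion y a z w
  rw [form_comm u a, hau, zero_smul, add_zero, hp, form_smul_right] at hu
  rw [form_comm w a, haw, zero_smul, add_zero, form_comm w z, hzw, zero_smul, zero_add, hp,
    form_smul_right] at hw
  ext i
  have h1 := congrFun hu i
  have h2 := congrFun hw i
  simp only [Pi.add_apply, Pi.smul_apply, smul_eq_mul, form_comm u, form_comm w] at h1 h2 ⊢
  have h3 : cross a z i = k * form z p * w i / form y w := by field_simp; linarith
  rw [h3] at h1
  field_simp
  field_simp at h1
  linarith

/-! ### Supporting directions and cutting off a corner -/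

namespace IsStarPolygon

variable {n m : ℕ} {v q : ZMod n → H2} {c C : ℝ}

/-- Positivity at the two neighbours makes `u` a positive combination of the two side normals, which
turns local support at a corner into global support. -/
theorem corner_pos (h : IsStarPolygon m v q c C) (i : ZMod n) {u : Fin 3 → ℝ}
    (hu : form (v i).1 u = 0) (h1 : 0 < form (v (i - 1)).1 u) (h2 : 0 < form (v (i + 1)).1 u)
    {j : ZMod n} (hj : j ≠ i) : 0 < form (v j).1 u := by
  have hD := h.orient_corner i
  rw [← sideNormal_pred] at hD
  have hp := h.orient_nonneg (i - 1) j
  rcases eq_or_ne j (i + 1) with rfl | hj'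
  · exact h2
  · have hn := h.orient i j hj hj'
    rw [h.pencil i hu, form_add_right, form_smul_right, form_smul_right]
    positivity

theorem hull_pos (h : IsStarPolygon m v q c C) (i : ZMod n) {u : Fin 3 → ℝ}
    (hu : form (v i).1 u = 0) (h1 : 0 < form (v (i - 1)).1 u) (h2 : 0 < form (v (i + 1)).1 u)
    {x : H2} (hx : x ∈ hull (Set.range v)) : 0 < form x.1 u ∨ x = v i := by
  refine hull_subset (isConvex_halfPlane_insert hu) ?_ hx
  rintro _ ⟨j, rfl⟩
  rcases eq_or_ne j i with rfl | hj
  · exact Or.inr rfl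
  · exact Or.inl (h.corner_pos i hu h1 h2 hj)

theorem axis_pos (h : IsStarPolygon m v q c C) {i j : ZMod n} (hj : j ≠ i) :
    0 < form (v j).1 (axis v q C i) :=
  h.corner_pos i (h.vertex_axis i) (h.axis_prev i) (h.axis_next i) hj

/-- A direction supporting at `v t` splits into the normal of a side at `v t` and the axis. -/
theorem pencil_split (h : IsStarPolygon m v q c C) (t : ZMod n) {u : Fin 3 → ℝ}
    (hu : form (v t).1 u = 0) (h1 : 0 ≤ form (v (t - 1)).1 u) (h2 : 0 ≤ form (v (t + 1)).1 u) :
    (∃ k l : ℝ, 0 ≤ k ∧ 0 ≤ l ∧ u = k • sideNormal v (t - 1) + l • axis v q C t) ∨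
      ∃ k l : ℝ, 0 ≤ k ∧ 0 ≤ l ∧ u = k • axis v q C t + l • sideNormal v t := by
  have hD := h.orient_corner t
  rw [← sideNormal_pred] at hD
  exact cone_split (div_pos (h.axis_next t) hD) (div_pos (h.axis_prev t) hD)
    (div_nonneg h2 hD.le) (div_nonneg h1 hD.le) (h.pencil t (h.vertex_axis t)) (h.pencil t hu)

theorem height_left_of_split (h : IsStarPolygon m v q c C) (t : ZMod n) {u : Fin 3 → ℝ} {k l : ℝ}
    (hk : 0 ≤ k) (hl : 0 ≤ l) (hu : u = k • sideNormal v (t - 1) + l • axis v q C t) :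
    c * lnorm u ≤ form (v (t + m)).1 u := by
  rw [hu]
  exact height_combination (v t) h.c_pos.le (vertex_sideNormal_pred v t) (h.vertex_axis t)
    (h.height_left t).ge (h.axis_height_left t).le hk hl

theorem height_right_of_split (h : IsStarPolygon m v q c C) (t : ZMod n) {u : Fin 3 → ℝ} {k l : ℝ}
    (hk : 0 ≤ k) (hl : 0 ≤ l) (hu : u = k • axis v q C t + l • sideNormal v t) :
    c * lnorm u ≤ form (v (t + m + 1)).1 u := by
  rw [hu]
  exact height_combination (v t) h.c_pos.le (h.vertex_axis t) (vertex_sideNormal v t)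
    (h.axis_height_right t).le (h.height_right t).ge hk hl

/-- Two points that together are high in all directions between a normal `p` and the axis. -/
theorem height_of_near_axis (h : IsStarPolygon m v q c C) (t : ZMod n) {x y p u : Fin 3 → ℝ}
    {k l r : ℝ} (hp : form (v t).1 p = 0) (hr : 0 < r)
    (hx : c * lnorm p ≤ form x p)
    (hx' : c * lnorm (p + r • axis v q C t) ≤ form x (p + r • axis v q C t))
    (hy' : c * lnorm (p + r • axis v q C t) ≤ form y (p + r • axis v q C t))
    (hy : c * lnorm (axis v q C t) ≤ form y (axis v q C t))
    (hk : 0 ≤ k) (hl : 0 ≤ l) (hu : u = k • p + l • axis v q C t) :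
    c * lnorm u ≤ form x u ∨ c * lnorm u ≤ form y u :=
  height_of_split (v t) h.c_pos.le hp (h.vertex_axis t) one_pos hr hk hl
    (by rw [one_smul]) hu hx hx' hy' hy

/-- A direction that is positive on the vertices of a polygon whose corner `v s` is cut off is
positive on this polygon. -/
theorem cut_pos (h : IsStarPolygon m v q c C) {s : ZMod n} {y z x : H2} {W u : Fin 3 → ℝ}
    {a b a' b' : ℝ} (hb : 0 < b) (hb' : 0 < b')
    (hy : y.1 = a • (v s).1 + b • (v (s - 1)).1) (hz : z.1 = a' • (v s).1 + b' • (v (s + 1)).1)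
    (hyW : form y.1 W = 0) (hzW : form z.1 W = 0) (hsW : form (v s).1 W < 0)
    (hvu : ∀ t, t ≠ s → 0 < form (v t).1 u) (hyu : 0 < form y.1 u) (hzu : 0 < form z.1 u)
    (hx : x ∈ hull (Set.range v)) (hxW : 0 ≤ form x.1 W) : 0 < form x.1 u := by
  rcases lt_or_ge 0 (form (v s).1 u) with hs | hs
  · refine hull_subset (isConvex_openHalfPlane u) ?_ hx
    rintro _ ⟨j, rfl⟩
    rcases eq_or_ne j s with rfl | hj
    · exact hs
    · exact hvu j hj
  -- `u - k • W` vanishes at `v s` and agrees with `u` at `y` and `z`, so it is positive at both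
  -- neighbours of `v s`. By `hull_pos` it is positive on the polygon off `v s`, and adding `k • W`
  -- back preserves this where `W` is nonnegative. No description of the truncated polygon as a hull
  -- is needed.
  · set k := form (v s).1 u / form (v s).1 W with hk
    have hk0 : 0 ≤ k := div_nonneg_of_nonpos hs hsW.le
    have hs' : form (v s).1 (u - k • W) = 0 := by
      rw [form_sub_right, form_smul_right, hk, div_mul_cancel₀ _ hsW.ne, sub_self]
    have hy' : 0 < form y.1 (u - k • W) := by
      rwa [form_sub_right, form_smul_right, hyW, mul_zero, sub_zero]
    have hz' : 0 < form z.1 (u - k • W) := by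
      rwa [form_sub_right, form_smul_right, hzW, mul_zero, sub_zero]
    rw [hy, form_add_left, form_smul_left, form_smul_left, hs', mul_zero, zero_add] at hy'
    rw [hz, form_add_left, form_smul_left, form_smul_left, hs', mul_zero, zero_add] at hz'
    rcases h.hull_pos s hs' (pos_of_mul_pos_right hy' hb.le) (pos_of_mul_pos_right hz' hb'.le) hx
      with hx' | rfl
    · rw [form_sub_right, form_smul_right] at hx'
      nlinarith [mul_nonneg hk0 hxW]
    · linarith

/-- Cutting off the corner `v s` by a line orthogonal to the axis, through a point near `v s`. -/
theorem exists_cut_direction (h : IsStarPolygon m v q c C) (s : ZMod n) {y₀ : H2}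
    (hy₀ : 0 < form y₀.1 (axis v q C s)) {Q : (Fin 3 → ℝ) → Prop}
    (hQ : ∀ᶠ y in 𝓝 (v s).1, Q y) :
    ∃ (W : Fin 3 → ℝ) (y : H2) (a b : ℝ), 0 < a ∧ 0 < b ∧
      y.1 = a • (v s).1 + b • (v (s - 1)).1 ∧ Q y.1 ∧ form y.1 W = 0 ∧ 0 < form W W ∧
      form (v s).1 W < 0 ∧ 0 < form y₀.1 W ∧ (∀ t, t ≠ s → 0 < form (v t).1 W) ∧
      c * lnorm W ≤ form (v (s + m)).1 W ∧ c * lnorm W ≤ form (v (s + m + 1)).1 W := by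
  have hc := h.c_pos
  have : NeZero n := ⟨by have := h.card_eq; omega⟩
  set w := axis v q C s with hw
  -- Chosen so that `w + R y • v s` vanishes at `y`. As `R` tends to zero at `v s`, strict
  -- inequalities for the axis survive for `y` near `v s`.
  set R : (Fin 3 → ℝ) → ℝ := fun y => -form y w / form y (v s).1 with hR
  have hcont : ∀ u, Continuous fun y : Fin 3 → ℝ => form y u := fun u =>
    continuous_form.comp (continuous_id.prodMk continuous_const)
  have hRt : Tendsto R (𝓝 (v s).1) (𝓝 0) := by
    have h1 : ContinuousAt R (v s).1 :=
      (hcont w).continuousAt.neg.div (hcont (v s).1).continuousAt (by rw [form_self]; norm_num)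
    have h2 : R (v s).1 = 0 := by simp [hR, hw, h.vertex_axis]
    rw [← h2]; exact h1
  have hlin : ∀ (a b : ℝ), 0 < a → ∀ᶠ y in 𝓝 (v s).1, 0 < a + R y * b := by
    intro a b ha
    have h1 : Tendsto (fun y => a + R y * b) (𝓝 (v s).1) (𝓝 (a + 0 * b)) :=
      (hRt.mul_const b).const_add a
    rw [zero_mul, add_zero] at h1
    exact h1.eventually (lt_mem_nhds ha)
  have hl := h.axis_height_left s
  have hr := h.axis_height_right s
  rw [h.lnorm_axis] at hl hr
  have hEv : ∀ᶠ y in 𝓝 (v s).1, Q y ∧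
      (∀ t : {t : ZMod n // t ≠ s}, 0 < form (v t).1 w + R y * form (v t).1 (v s).1) ∧
      0 < form y₀.1 w + R y * form y₀.1 (v s).1 ∧
      0 < (form (v (s + m)).1 w - c * c) + R y * form (v (s + m)).1 (v s).1 ∧
      0 < (form (v (s + m + 1)).1 w - c * c) + R y * form (v (s + m + 1)).1 (v s).1 ∧
      0 < c + R y * (-1) :=
    hQ.and <| (eventually_all.mpr fun t => hlin _ _ (h.axis_pos t.2)).and <|
      (hlin _ _ hy₀).and <| (hlin _ _ (sub_pos.mpr hl)).and <| (hlin _ _ (sub_pos.mpr hr)).and <|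
      hlin _ _ hc
  obtain ⟨y, a, b, ha, hb, hy, hQy, hvW, hy₀W, hAW, hBW, hRc⟩ :=
    exists_near (v s) (v (s - 1)) hEv
  have hyw : 0 < form y.1 w := by
    rw [hy, form_add_left, form_smul_left, form_smul_left, hw, h.vertex_axis, mul_zero, zero_add]
    exact mul_pos hb (h.axis_prev s)
  have hys := form_neg y (v s)
  have hr0 : 0 < R y.1 := div_pos_of_neg_of_neg (by linarith) hys
  have hrR : R y.1 * form y.1 (v s).1 = -form y.1 w := div_mul_cancel₀ _ hys.ne
  generalize R y.1 = r at hvW hy₀W hAW hBW hRc hr0 hrR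
  have hWform : ∀ p : Fin 3 → ℝ, form p (w + r • (v s).1) = form p w + r * form p (v s).1 :=
    fun p => by rw [form_add_right, form_smul_right]
  have hsw : form (v s).1 w = 0 := h.vertex_axis s
  have hww : form w w = c ^ 2 := h.form_axis_self s
  generalize w + r • (v s).1 = W at hWform
  have hsW : form (v s).1 W = -r := by
    rw [hWform, hsw, form_self]; ring
  have hWW : form W W = c ^ 2 - r ^ 2 := by
    rw [hWform, form_comm W, form_comm W, hsW, hWform, form_comm w (v s).1, hsw, hww]
    ring
  have hWc : c * lnorm W ≤ c * c := by
    refine mul_le_mul_of_nonneg_left ?_ hc.le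
    rw [lnorm, hWW]
    exact Real.sqrt_le_iff.mpr ⟨hc.le, by nlinarith⟩
  refine ⟨W, y, a, b, ha, hb, hy, hQy, ?_, ?_, ?_, ?_, fun t ht => ?_, ?_, ?_⟩
  · rw [hWform, hrR]; ring
  · rw [hWW]; nlinarith
  · linarith
  · rw [hWform]; exact hy₀W
  · rw [hWform]; exact hvW ⟨t, ht⟩
  · rw [hWform]; linarith
  · rw [hWform]; linarith

/-- The height of the opposite vertex in the directions supporting at an end of the cut. -/
theorem height_of_cut_end {c : ℝ} (hc : 0 ≤ c) {y z r p : H2} {x N W u : Fin 3 → ℝ}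
    {a b a' b' : ℝ} (ha : 0 < a) (hb' : 0 < b') (hy : y.1 = a • r.1 + b • p.1)
    {t : H2} (hz : z.1 = a' • r.1 + b' • t.1) (hyW : form y.1 W = 0) (hzW : form z.1 W = 0)
    {k : ℝ} (hk : k ≠ 0) (hN : cross p.1 r.1 = k • N) (htN : 0 < form t.1 N)
    (hpW : 0 < form p.1 W) (hxN : c * lnorm N ≤ form x N) (hxW : c * lnorm W ≤ form x W)
    (hyu : form y.1 u = 0) (hzu : 0 ≤ form z.1 u) (hpu : 0 ≤ form p.1 u) :
    c * lnorm u ≤ form x u := by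
  have hrN : form r.1 N = 0 := by
    have : form r.1 (cross p.1 r.1) = 0 := form_cross_right _ _
    rw [hN, form_smul_right] at this
    exact (mul_eq_zero.mp this).resolve_left hk
  have hpN : form p.1 N = 0 := by
    have : form p.1 (cross p.1 r.1) = 0 := form_cross_left _ _
    rw [hN, form_smul_right] at this
    exact (mul_eq_zero.mp this).resolve_left hk
  have hyN : form y.1 N = 0 := by
    rw [hy, form_add_left, form_smul_left, form_smul_left, hrN, hpN]; ring
  have hzN : 0 < form z.1 N := by
    rw [hz, form_add_left, form_smul_left, form_smul_left, hrN, mul_zero, zero_add]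
    exact mul_pos hb' htN
  -- Moving the vertex `r` to `y` on the same side only rescales the side normal.
  have hcr : cross p.1 y.1 = (a * k) • N := by
    rw [hy, cross_add_right, cross_smul_right, cross_smul_right, cross_self, smul_zero,
      add_zero, hN, smul_smul]
  rw [pencil_combination (mul_ne_zero ha.ne' hk) hcr hzN hyW hzW hpW hyu]
  exact height_combination y hc hyN hyW hxN hxW (div_nonneg hzu hzN.le) (div_nonneg hpu hpW.le)

/-- If a vertex is farther from the side opposite to `v s` than `v s`, then a small piece of the
polygon can be cut off at `v s` without decreasing the thickness. -/
theorem exists_cut (h : IsStarPolygon m v q c C) {s x : ZMod n}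
    (hx : c * lnorm (sideNormal v (s + m)) < form (v x).1 (sideNormal v (s + m))) {y₀ : H2}
    (hy₀ : 0 < form y₀.1 (axis v q C s)) :
    ∃ W : Fin 3 → ℝ, 0 < form W W ∧ form (v s).1 W < 0 ∧ 0 < form y₀.1 W ∧
      (∃ y ∈ seg (v s) (v (s - 1)), form y.1 W = 0) ∧
      ∀ u, (∀ p ∈ hull (Set.range v), 0 ≤ form p.1 W → 0 ≤ form p.1 u) →
        (∃ p ∈ hull (Set.range v), 0 ≤ form p.1 W ∧ form p.1 u = 0) →
        ∃ p ∈ hull (Set.range v), 0 ≤ form p.1 W ∧ c * lnorm u ≤ form p.1 u := by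
  have hc := h.c_pos
  have e₁ : s + m + m + 1 = s := by linear_combination h.m_add
  have e₂ : s + m + 1 + m = s := by linear_combination h.m_add
  have e₃ : s + (m : ZMod n) + 1 - 1 = s + m := by ring
  have hAs : s + (m : ZMod n) ≠ s := fun e => h.m_ne (by linear_combination e)
  have hBs : s + (m : ZMod n) + 1 ≠ s := fun e => h.m_succ_ne (by linear_combination e)
  have hnext : s + 1 ≠ s := fun e => h.one_ne (by linear_combination e)
  have hprev : s - 1 ≠ s := fun e => h.one_ne (by linear_combination -e)
  have hxs : x ≠ s := by rintro rfl; rw [h.height] at hx; exact hx.false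
  have hsN : c * lnorm (sideNormal v (s + m)) ≤ form (v s).1 (sideNormal v (s + m)) :=
    (h.height s).ge
  have hA := h.axis_height_right (s + m)
  rw [e₁] at hA
  have hB := h.axis_height_left (s + m + 1)
  rw [e₂] at hB
  -- At either end of the opposite side, `v x` is high up to an intermediate direction, at which `v
  -- s` is already strictly higher than `c`. As `v s` is also strictly high on the axis, a nearby
  -- `y` can replace it from there on.
  obtain ⟨k₁, hk₁, hx₁, hs₁⟩ := exists_intermediate (v (s + m)) hc.le (vertex_sideNormal v _)
    (h.vertex_axis (s + m)) hx hsN hA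
  obtain ⟨k₂, hk₂, hx₂, hs₂⟩ := exists_intermediate (v (s + m + 1)) hc.le
    (vertex_succ_sideNormal v _) (h.vertex_axis (s + m + 1)) hx hsN hB
  have hnear : ∀ (a : ℝ) (u : Fin 3 → ℝ), a < form (v s).1 u →
      ∀ᶠ y in 𝓝 (v s).1, a < form y u := fun a u hau =>
    (continuous_form.comp (continuous_id.prodMk continuous_const)).continuousAt.eventually
      (lt_mem_nhds hau)
  obtain ⟨W, y, a, b, ha, hb, hy, ⟨⟨hyA₁, hyA₂⟩, hyB₁, hyB₂⟩, hyW, hWW, hsW, hy₀W, hvW, hAW, hBW⟩ :=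
    h.exists_cut_direction s hy₀
      (((hnear _ _ hs₁).and (hnear _ _ hA)).and ((hnear _ _ hs₂).and (hnear _ _ hB)))
  -- The other end of the cut: these coefficients make `W` vanish on the side from `v s` to `v (s +
  -- 1)`.
  obtain ⟨z, ρ, hρ, hz⟩ := exists_normalized (v s) (v (s + 1)) (hvW _ hnext).le
    (neg_nonneg.mpr hsW.le) (add_pos (hvW _ hnext) (neg_pos.mpr hsW))
  rw [smul_add, smul_smul, smul_smul] at hz
  have ha' := mul_pos hρ (hvW _ hnext)
  have hb' := mul_pos hρ (neg_pos.mpr hsW)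
  have hzW : form z.1 W = 0 := by
    rw [hz, form_add_left, form_smul_left, form_smul_left]; ring
  generalize ρ * form (v (s + 1)).1 W = a' at hz ha'
  generalize ρ * -form (v s).1 W = b' at hz hb'
  have hyseg : y ∈ seg (v s) (v (s - 1)) := ⟨a, b, ha.le, hb.le, hy⟩
  have hvV : ∀ t, v t ∈ hull (Set.range v) := fun t => subset_hull _ ⟨t, rfl⟩
  have hyV : y ∈ hull (Set.range v) := fun K hK => hK.1 _ (hK.2 ⟨s, rfl⟩) _ (hK.2 ⟨_, rfl⟩) hyseg
  have hzV : z ∈ hull (Set.range v) := fun K hK =>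
    hK.1 _ (hK.2 ⟨s, rfl⟩) _ (hK.2 ⟨_, rfl⟩) ⟨a', b', ha'.le, hb'.le, hz⟩
  refine ⟨W, hWW, hsW, hy₀W, ⟨y, hyseg, hyW⟩, fun u hu htouch => ?_⟩
  have hvu : ∀ t, t ≠ s → 0 ≤ form (v t).1 u := fun t ht => hu _ (hvV t) (hvW t ht).le
  have hyu : 0 ≤ form y.1 u := hu _ hyV hyW.ge
  have hzu : 0 ≤ form z.1 u := hu _ hzV hzW.ge
  have hvert : ∀ t, t ≠ s → c * lnorm u ≤ form (v t).1 u →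
      ∃ p ∈ hull (Set.range v), 0 ≤ form p.1 W ∧ c * lnorm u ≤ form p.1 u := fun t ht htu =>
    ⟨v t, hvV t, (hvW t ht).le, htu⟩
  have hyh : c * lnorm u ≤ form y.1 u →
      ∃ p ∈ hull (Set.range v), 0 ≤ form p.1 W ∧ c * lnorm u ≤ form p.1 u := fun hyu =>
    ⟨y, hyV, hyW.ge, hyu⟩
  by_cases hty : form y.1 u = 0
  · refine hvert (s + m) hAs ?_
    refine height_of_cut_end hc.le ha hb' hy hz hyW hzW one_ne_zero
      (N := sideNormal v (s - 1)) (by rw [one_smul, sideNormal_pred]) ?_ (hvW _ hprev)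
      (h.height_left s).ge hAW hty hzu (hvu _ hprev)
    rw [sideNormal_pred]
    exact h.orient_corner s
  by_cases htz : form z.1 u = 0
  · refine hvert (s + m + 1) hBs ?_
    refine height_of_cut_end hc.le ha' hb hz hy hzW hyW (neg_ne_zero.mpr one_ne_zero)
      (N := sideNormal v s) ?_ (h.orient s (s - 1) hprev fun e => h.two_ne (by linear_combination -e))
      (hvW _ hnext) (h.height_right s).ge hBW htz hyu (hvu _ hnext)
    ext i; fin_cases i <;> simp [cross, sideNormal] <;> ring
  -- A supporting line missing both ends of the cut must touch a surviving vertex.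
  obtain ⟨t, hts, htu⟩ : ∃ t, t ≠ s ∧ form (v t).1 u = 0 := by
    by_contra! hcon
    obtain ⟨p, hpV, hpW, hpu⟩ := htouch
    have := h.cut_pos hb hb' hy hz hyW hzW hsW
      (fun t ht => lt_of_le_of_ne (hvu t ht) (hcon t ht).symm) (lt_of_le_of_ne hyu (Ne.symm hty))
      (lt_of_le_of_ne hzu (Ne.symm htz)) hpV hpW
    exact this.ne' hpu
  -- If the neighbour is the removed vertex, its sign is recovered from the end of the cut on that
  -- side.
  have hprev' : 0 ≤ form (v (t - 1)).1 u := by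
    rcases eq_or_ne (t - 1) s with e | e
    · have e' : s + 1 = t := by rw [← e]; ring
      rw [e]
      rw [hz, form_add_left, form_smul_left, form_smul_left, e', htu, mul_zero, add_zero] at hzu
      exact nonneg_of_mul_nonneg_right hzu ha'
    · exact hvu _ e
  have hnext' : 0 ≤ form (v (t + 1)).1 u := by
    rcases eq_or_ne (t + 1) s with e | e
    · have e' : s - 1 = t := by rw [← e]; ring
      rw [e]
      rw [hy, form_add_left, form_smul_left, form_smul_left, e', htu, mul_zero, add_zero] at hyu
      exact nonneg_of_mul_nonneg_right hyu ha
    · exact hvu _ e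
  rcases h.pencil_split t htu hprev' hnext' with ⟨k, l, hk, hl, hukl⟩ | ⟨k, l, hk, hl, hukl⟩
  · by_cases ht : t + m = s
    · obtain rfl : t = s + m + 1 := by linear_combination ht - h.m_add
      rw [e₃] at hukl
      rcases h.height_of_near_axis (s + m + 1) (vertex_succ_sideNormal v _) hk₂ hx.le hx₂ hyB₁.le
        hyB₂.le hk hl hukl with h1 | h1
      · exact hvert x hxs h1
      · exact hyh h1
    · exact hvert _ ht (h.height_left_of_split t hk hl hukl)
  · by_cases ht : t + m + 1 = s
    · obtain rfl : t = s + m := by linear_combination ht - h.m_add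
      rcases h.height_of_near_axis (s + m) (vertex_sideNormal v _) hk₁ hx.le hx₁ hyA₁.le
        hyA₂.le hl hk (hukl.trans (add_comm _ _)) with h1 | h1
      · exact hvert x hxs h1
      · exact hyh h1
    · exact hvert _ ht (h.height_right_of_split t hk hl hukl)

/-- Points just beyond `v s`, on the ray away from the foot, are negative on the axis and so lie
outside the polygon. -/
theorem vertex_notMem_interior (h : IsStarPolygon m v q c C) (s : ZMod n) :
    v s ∉ interior (hull (Set.range v)) := by
  intro hs
  have hfs := h.form_vertex_foot s
  have hC := h.C_pos
  -- The reflection of `q s` in the point `v s`.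
  obtain ⟨x, hx⟩ := exists_point_of_form_neg (y := (2 * C) • (v s).1 - (q s).1) (v s) (by
      simp only [form_sub_left, form_sub_right, form_smul_left, form_smul_right, form_self, hfs,
        form_comm (q s).1 (v s).1]
      ring) (by
      simp only [form_sub_left, form_smul_left, form_self, hfs, form_comm (q s).1 (v s).1]
      linarith)
  obtain ⟨O, hO, hOeq⟩ := isOpen_induced_iff.mp
    (isOpen_interior (s := hull (Set.range v)))
  have hsO : (v s).1 ∈ O := by
    have : v s ∈ Subtype.val ⁻¹' O := hOeq ▸ hs
    exact this
  obtain ⟨y, a, b, ha, hb, hy, hyO⟩ := exists_near (v s) x (hO.mem_nhds hsO)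
  have hyV : y ∈ interior (hull (Set.range v)) := by
    rw [← hOeq]; exact hyO
  have hxw : form x.1 (axis v q C s) = -c ^ 2 := by
    rw [hx, form_sub_left, form_smul_left, h.vertex_axis, axis, form_sub_right, form_smul_right,
      form_self, form_comm (q s).1 (v s).1, hfs]
    nlinarith [h.sq_eq]
  have hyw : form y.1 (axis v q C s) = -(b * c ^ 2) := by
    rw [hy, form_add_left, form_smul_left, form_smul_left, h.vertex_axis, hxw]; ring
  have hneg : 0 < b * c ^ 2 := mul_pos hb (pow_pos h.c_pos 2)
  rcases h.hull_pos s (h.vertex_axis s) (h.axis_prev s) (h.axis_next s) (interior_subset hyV)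
    with h1 | h1
  · linarith
  · rw [h1, h.vertex_axis] at hyw
    linarith

/-- In a reduced polygon no vertex is farther from a side than the opposite vertex. -/
theorem height_le (h : IsStarPolygon m v q c C) {d : ℝ} (hd : 0 < d) (hcd : c = Real.sinh d)
    (hV : IsConvexBody (hull (Set.range v)))
    (hred : ∀ Z, IsConvexBody Z → Z ⊂ hull (Set.range v) → thickness Z < d) (s x : ZMod n) :
    form (v x).1 (sideNormal v (s + m)) ≤ c * lnorm (sideNormal v (s + m)) := by
  by_contra! hx
  obtain ⟨hconv, hcomp, hint⟩ := hV
  have hpos : ∀ p ∈ hull (Set.range v), 0 < form p.1 (axis v q C s) ∨ p = v s := fun p hp =>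
    h.hull_pos s (h.vertex_axis s) (h.axis_prev s) (h.axis_next s) hp
  -- This interior point is kept on the positive side of the cut, so that the truncated polygon has
  -- interior.
  obtain ⟨y₀, hy₀⟩ := hint
  have hy₀s : y₀ ≠ v s := by
    rintro rfl
    exact h.vertex_notMem_interior s hy₀
  have hy₀w := (hpos y₀ (interior_subset hy₀)).resolve_right hy₀s
  obtain ⟨W, hWW, hsW, hy₀W, ⟨y, hyseg, hyW⟩, hcut⟩ := h.exists_cut hx hy₀w
  have hclosed : IsClosed {p : H2 | 0 ≤ form p.1 W} :=
    isClosed_le continuous_const (continuous_form_right W)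
  have hopen : IsOpen {p : H2 | 0 < form p.1 W} :=
    isOpen_lt continuous_const (continuous_form_right W)
  set Z := hull (Set.range v) ∩ {p : H2 | 0 ≤ form p.1 W} with hZ
  have hZc : IsCompact Z := hcomp.inter_right hclosed
  have hyZ : y ∈ Z :=
    ⟨hconv _ (subset_hull _ ⟨s, rfl⟩) _ (subset_hull _ ⟨_, rfl⟩) hyseg, hyW.ge⟩
  have hZb : IsConvexBody Z := by
    refine ⟨hconv.inter (isConvex_halfPlane W), hZc, y₀, ?_⟩
    refine interior_mono (s := interior (hull (Set.range v)) ∩ {p : H2 | 0 < form p.1 W}) ?_ ?_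
    · exact fun p hp => ⟨interior_subset hp.1, (show 0 < form p.1 W from hp.2).le⟩
    · rw [(isOpen_interior.inter hopen).interior_eq]
      exact ⟨hy₀, hy₀W⟩
  have hss : Z ⊂ hull (Set.range v) := by
    refine ⟨Set.inter_subset_left, fun hsub => ?_⟩
    have : 0 ≤ form (v s).1 W := (hsub (subset_hull _ ⟨s, rfl⟩)).2
    linarith
  refine (hred Z hZb hss).not_ge (le_thickness hZc hd ⟨W, hWW, fun p hp => hp.2, y, hyZ, hyW⟩ ?_)
  intro u huu hZu p hp hpu
  obtain ⟨z, hzV, hzW, hz⟩ := hcut u (fun p hp hpW => hZu p ⟨hp, hpW⟩) ⟨p, hp.1, hp.2, hpu⟩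
  refine ⟨z, ⟨hzV, hzW⟩, ?_⟩
  rw [lnorm, huu, Real.sqrt_one, mul_one, hcd] at hz
  exact hz

end IsStarPolygon

/-! ### The diameter -/

/-- The Grassmann–Plücker relation for the lines joining `o` to four points. -/
theorem pluecker (o a b c d : Fin 3 → ℝ) :
    form c (cross o a) * form d (cross o b)
      = form b (cross o a) * form d (cross o c) + form d (cross o a) * form c (cross o b) := by
  simp [form, cross]; ring

/-- Points of a convex hull at maximal distance from a given point belong to the generating set. -/
theorem mem_of_farthest {S : Set H2} {p q : H2} (hp : p ∈ hull S)
    (hmax : ∀ x ∈ hull S, form p.1 q.1 ≤ form x.1 q.1) : p ∈ S := by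
  have hneg := form_neg p q
  -- A proper combination of two different points has coefficient sum below one, and `form p q` is
  -- negative; so it falls into the strict alternative.
  have hK : IsConvex {x : H2 | form p.1 q.1 < form x.1 q.1 ∨ (x ∈ S ∧
      form p.1 q.1 ≤ form x.1 q.1)} := by
    have hle : ∀ x : H2, (form p.1 q.1 < form x.1 q.1 ∨ (x ∈ S ∧
      form p.1 q.1 ≤ form x.1 q.1)) → form p.1 q.1 ≤ form x.1 q.1 := by
      rintro x (h | h)
      exacts [h.le, h.2]
    rintro x hx y hy z ⟨a, b, ha, hb, hz⟩
    rcases ha.eq_or_lt with rfl | ha'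
    · have : z = y := eq_of_smul hb (by simpa using hz)
      exact this ▸ hy
    rcases hb.eq_or_lt with rfl | hb'
    · have : z = x := eq_of_smul ha (by simpa using hz)
      exact this ▸ hx
    rcases eq_or_ne x y with rfl | hxy
    · have : z = x := eq_of_smul (b := a + b) (by positivity) (by rw [hz, add_smul])
      exact this ▸ hx
    · have hab := add_lt_one_of_combination ha' hb' hxy hz
      have hx' := hle x hx
      have hy' := hle y hy
      left
      rw [hz, form_add_left, form_smul_left, form_smul_left]
      nlinarith [mul_le_mul_of_nonneg_left hx' ha, mul_le_mul_of_nonneg_left hy' hb]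
  rcases hull_subset hK (fun x hx => Or.inr ⟨hx, hmax x (subset_hull S hx)⟩) hp with h | h
  · exact absurd h (lt_irrefl _)
  · exact h.1

/-- The diameter of a compact set is attained. -/
theorem exists_isGreatest_hdist {C : Set H2} (hC : IsCompact C) (hne : C.Nonempty) :
    ∃ p ∈ C, ∃ q ∈ C, hdist p q = hdiam C ∧ ∀ x ∈ C, ∀ y ∈ C, hdist x y ≤ hdiam C := by
  obtain ⟨x, hx⟩ := hne
  obtain ⟨⟨p, q⟩, ⟨hp, hq⟩, hmax⟩ := (hC.prod hC).exists_isMaxOn ⟨(x, x), hx, hx⟩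
    (f := fun x : H2 × H2 => -form x.1.1 x.2.1) continuous_form_points.neg.continuousOn
  have hle : ∀ x ∈ C, ∀ y ∈ C, hdist x y ≤ hdist p q := fun x hx y hy =>
    hdist_le_hdist.mpr (hmax (show (x, y) ∈ C ×ˢ C from ⟨hx, hy⟩))
  have hd : hdiam C = hdist p q := by
    refine IsGreatest.csSup_eq ⟨⟨p, hp, q, hq, rfl⟩, ?_⟩
    rintro r ⟨x, hx, y, hy, rfl⟩
    exact hle x hx y hy
  exact ⟨p, hp, q, hq, hd.symm, fun x hx y hy => hd ▸ hle x hx y hy⟩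

/-- Coordinates in the tangent plane of `p`: the tangent to `z` and the normal of the line `z p`. -/
theorem tangent_parseval (p z x : H2) :
    form (tangent p z) x.1 ^ 2 + form x.1 (cross z.1 p.1) ^ 2
      = (form p.1 z.1 ^ 2 - 1) * (form p.1 x.1 ^ 2 - 1) := by
  rw [sq_form_cross, form_self, form_self, form_self, tangent, form_add_left, form_smul_left,
    form_comm z.1 p.1, form_comm x.1 p.1, form_comm z.1 x.1]
  ring

namespace IsStarPolygon

variable {n m : ℕ} {v q : ZMod n → H2} {c C : ℝ}

theorem add_natCast_ne (h : IsStarPolygon m v q c C) (j : ZMod n) {a b : ℕ} (ha : a < n)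
    (hb : b < n) (hab : a ≠ b) : j + (a : ZMod n) ≠ j + b := fun e =>
  h.natCast_ne ha hb hab (add_left_cancel e)

/-- Three vertices in cyclic order are positively oriented. -/
theorem orient_of_lt (h : IsStarPolygon m v q c C) (j : ZMod n) {s t : ℕ} (hs : 0 < s)
    (hst : s < t) (ht : t < n) :
    0 < form (v (j + t)).1 (cross (v j).1 (v (j + s)).1) := by
  have hone : ∀ t : ℕ, 1 < t → t < n → 0 < form (v (j + t)).1 (cross (v j).1 (v (j + 1)).1) := by
    intro t h1 h2
    refine h.orient j (j + t) ?_ ?_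
    · simpa using h.add_natCast_ne j h2 (b := 0) (by omega) (by omega)
    · simpa using h.add_natCast_ne j h2 (b := 1) (by omega) (by omega)
  have hsucc : ∀ t : ℕ, 0 < t → t + 1 < n →
      0 < form (v (j + (t + 1 : ℕ))).1 (cross (v j).1 (v (j + t)).1) := by
    intro t h1 h2
    rw [form_cross_rotate, Nat.cast_add, Nat.cast_one, ← add_assoc]
    refine h.orient (j + t) j ?_ ?_
    · simpa using h.add_natCast_ne j (a := 0) (b := t) (by omega) (by omega) (by omega)
    · have := h.add_natCast_ne j (a := 0) (b := t + 1) (by omega) (by omega) (by omega)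
      rw [Nat.cast_add, Nat.cast_one, ← add_assoc] at this
      simpa using this
  induction t, hst using Nat.le_induction with
  | base => exact hsucc s hs ht
  | succ t hst ih =>
    have hst : s < t := hst
    have h1 := ih (by omega)
    have h2 := hone t (by omega) (by omega)
    have h3 := hone (t + 1) (by omega) ht
    have h4 := hsucc t (by omega) ht
    -- Only nonnegative, since it vanishes for `s = 1`; the other term of the Plücker relation is
    -- strictly positive.
    have h5 := h.orient_nonneg j (j + s)
    rw [sideNormal] at h5
    have h6 := pluecker (v j).1 (v (j + 1)).1 (v (j + s)).1 (v (j + t)).1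
      (v (j + (t + 1 : ℕ))).1
    refine pos_of_mul_pos_right ?_ h2.le
    rw [h6]
    have := mul_nonneg h5 h4.le
    have := mul_pos h3 h1
    linarith

/-- Vertices whose indices differ by less than `m` are not at maximal distance. -/
theorem not_farthest (h : IsStarPolygon m v q c C)
    (hle : ∀ s x, form (v x).1 (sideNormal v (s + m)) ≤ c * lnorm (sideNormal v (s + m)))
    (j : ZMod n) {k : ℕ} (hk : 0 < k) (hkm : k < m)
    (hmax : ∀ a b, form (v j).1 (v (j + k)).1 ≤ form (v a).1 (v b).1) : False := by
  have hn := h.card_eq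
  have hne : v j ≠ v (j - 1) := h.ne_of_ne fun e => h.one_ne (by linear_combination e)
  have hg := form_lt_neg_one hne
  have hz := form_tangent_target hne
  have hp1 := h.tangent_left j
  have hp2 := h.height_left j
  have hq2 := hle (j + m) (j + k)
  rw [h.add_m_add_m, ← hp2] at hq2
  have hq0 := h.orient_nonneg (j - 1) (j + k)
  have hor := h.orient_of_lt j hk hkm (by omega)
  have hD := form_neg (v j) (v (j + k))
  -- `v (j - 1)` is no farther from `v (j + k)` than `v j` is, so the angle at `v j` is acute.
  have hq1 : 0 < form (tangent (v j) (v (j - 1))) (v (j + k)).1 := by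
    have := hmax (j - 1) (j + k)
    rw [tangent, form_add_left, form_smul_left]
    nlinarith
  have h4 := four_vectors (v j).1 (v (j - 1)).1 (v (j + k)).1 (v (j + m)).1
    (tangent (v j) (v (j - 1)))
  rw [form_tangent_base, form_cross_swap (v j).1 (v (j - 1)).1,
    form_cross_swap (v j).1 (v (j - 1)).1, ← sideNormal_pred] at h4
  have hq := tangent_parseval (v j) (v (j - 1)) (v (j + k))
  have hp := tangent_parseval (v j) (v (j - 1)) (v (j + m))
  rw [← sideNormal_pred] at hq hp
  have hsq : form (v j).1 (v (j + m)).1 ^ 2 ≤ form (v j).1 (v (j + k)).1 ^ 2 := by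
    nlinarith [hmax j (j + m), form_neg (v j) (v (j + m))]
  have hG : 0 < form (v j).1 (v (j - 1)).1 ^ 2 - 1 := by nlinarith
  have hpq : form (tangent (v j) (v (j - 1))) (v (j + m)).1 ^ 2
        + form (v (j + m)).1 (sideNormal v (j - 1)) ^ 2
      ≤ form (tangent (v j) (v (j - 1))) (v (j + k)).1 ^ 2
        + form (v (j + k)).1 (sideNormal v (j - 1)) ^ 2 := by
    rw [hq, hp]
    exact mul_le_mul_of_nonneg_left (by linarith) hG.le
  have hpos := mul_pos hor hz
  generalize form (tangent (v j) (v (j - 1))) (v (j + m)).1 = p1 at *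
  generalize form (tangent (v j) (v (j - 1))) (v (j + k)).1 = q1 at *
  generalize form (v (j + k)).1 (sideNormal v (j - 1)) = q2 at *
  generalize form (v (j + m)).1 (sideNormal v (j - 1)) = p2 at *
  -- The orientation gives `v (j + k)` the larger angle. With `q2 ≤ p2` this forces `q1 < p1`,
  -- contradicting `hpq`.
  have h5 : p2 * q1 < q2 * p1 := by nlinarith
  have h6 : q2 * p1 ≤ p2 * p1 := mul_le_mul_of_nonneg_right hq2 hp1.le
  have h7 : q1 < p1 := by nlinarith
  nlinarith

/-- Pairs of points of the polygon at maximal distance are pairs of almost opposite vertices. -/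
theorem farthest_pair (h : IsStarPolygon m v q c C)
    (hle : ∀ s x, form (v x).1 (sideNormal v (s + m)) ≤ c * lnorm (sideNormal v (s + m)))
    {x y : H2} (hx : x ∈ hull (Set.range v)) (hy : y ∈ hull (Set.range v))
    (hmax : ∀ p ∈ hull (Set.range v), ∀ r ∈ hull (Set.range v),
      form x.1 y.1 ≤ form p.1 r.1) :
    ∃ i j : ZMod n, x = v i ∧ y = v j ∧ (j = i + (m : ℕ) ∨ j = i + (m + 1 : ℕ)) := by
  have hn := h.card_eq
  have : NeZero n := ⟨by omega⟩
  obtain ⟨i, rfl⟩ := mem_of_farthest hx fun p hp => hmax p hp y hy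
  obtain ⟨j, rfl⟩ := mem_of_farthest hy fun p hp => by
    rw [form_comm, form_comm p.1]; exact hmax _ hx p hp
  have hv : ∀ t, v t ∈ hull (Set.range v) := fun t => subset_hull _ ⟨t, rfl⟩
  have hmax' : ∀ a b, form (v i).1 (v j).1 ≤ form (v a).1 (v b).1 := fun a b =>
    hmax _ (hv a) _ (hv b)
  refine ⟨i, j, rfl, rfl, ?_⟩
  obtain ⟨k, hk, hkj⟩ : ∃ k : ℕ, k < n ∧ j = i + k :=
    ⟨(j - i).val, ZMod.val_lt _, by rw [ZMod.natCast_zmod_val]; ring⟩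
  subst hkj
  by_contra! hcon
  have hkm : k ≠ m := by rintro rfl; exact hcon.1 rfl
  have hkm1 : k ≠ m + 1 := by rintro rfl; exact hcon.2 rfl
  rcases Nat.eq_zero_or_pos k with rfl | hk0
  · have h1 := hmax' i (i + 1)
    have h2 := form_lt_neg_one (h.ne_of_ne (i := i) (j := i + 1)
      fun e => h.one_ne (by linear_combination -e))
    rw [Nat.cast_zero, add_zero, form_self] at h1
    linarith
  rcases lt_or_ge k m with hlt | hge
  · exact h.not_farthest hle i hk0 hlt hmax'
  -- Here `k ≥ m + 2`; going on from `v (i + k)`, the vertex `v i` is reached after `n - k < m`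
  -- steps.
  · have hi : i + k + ((n - k : ℕ) : ZMod n) = i := by
      rw [add_assoc, ← Nat.cast_add, Nat.add_sub_cancel' hk.le, ZMod.natCast_self, add_zero]
    refine h.not_farthest hle (i + k) (k := n - k) (by omega) (by omega) fun a b => ?_
    rw [hi, form_comm]
    exact hmax' a b

end IsStarPolygon

/-! ### From the definition to the metric data -/

/-- The metric data of an ordinary reduced polygon. -/
theorem IsOrdinaryReducedPolygon.exists_isStarPolygon {n : ℕ} {V : Set H2} {v : ZMod n → H2}
    (hV : IsOrdinaryReducedPolygon n V v) :
    0 < thickness V ∧ ∃ q : ZMod n → H2, IsStarPolygon ((n - 1) / 2) v q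
      (Real.sinh (thickness V)) (Real.cosh (thickness V)) := by
  obtain ⟨hodd, ⟨hn3, -, -, hor⟩, -, hopp⟩ := hV
  obtain ⟨m, hm⟩ := hodd
  have e1 : (n - 1) / 2 = m := by omega
  have e2 : (n + 1) / 2 = m + 1 := by omega
  simp only [e1, e2, Nat.cast_add, Nat.cast_one, ← add_assoc] at hopp
  rw [e1]
  have hnc : ∀ a : ℕ, 0 < a → a < n → (a : ZMod n) ≠ 0 := fun a h1 h2 h3 =>
    absurd (Nat.le_of_dvd h1 ((ZMod.natCast_eq_zero_iff _ _).mp h3)) (by omega)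
  have hor' : ∀ i j, j ≠ i → j ≠ i + 1 → 0 < form (v j).1 (sideNormal v i) := by
    intro i j h1 h2
    rw [sideNormal, form_cross_eq_det]
    exact hor i j h1 h2
  have hpos : ∀ i, 0 < form (v i).1 (sideNormal v (i + m)) := by
    intro i
    refine hor' _ _ (fun e => hnc m (by omega) (by omega) (by linear_combination -e))
      fun e => hnc (m + 1) (by omega) (by omega) ?_
    push_cast
    linear_combination -e
  choose hq hwidth using hopp
  choose q hqmem hproj using hq
  have hdist' : ∀ i, thickness V = hdist (v i) (q i) := fun i => by
    rw [← hwidth i, distToSet_eq_of_isProjection (hproj i)]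
  have hcosh : ∀ i, Real.cosh (thickness V) = -form (v i).1 (q i).1 := fun i => by
    rw [hdist' i, cosh_hdist]
  have hfoot := fun i => foot_of_isProjection (hpos i) (hproj i)
  have hd0 : 0 ≤ thickness V := by rw [hdist' 0]; exact hdist_nonneg _ _
  -- Zero thickness would put `v 0` on the line of its opposite side, against the orientation.
  have hd : 0 < thickness V := by
    refine lt_of_le_of_ne hd0 fun h0 => ?_
    have h1 := hcosh 0
    rw [← h0, Real.cosh_zero] at h1
    have h2 := (hfoot 0).2
    have h3 : form (v 0).1 (q 0).1 ^ 2 - 1 = 0 := by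
      rw [show form (v 0).1 (q 0).1 = -1 by linarith]; norm_num
    rw [h3, zero_mul] at h2
    have := pow_pos (hpos 0) 2
    rw [sideNormal] at this
    exact this.ne' h2
  refine ⟨hd, q, ⟨hm, by omega, Real.sinh_pos_iff.mpr hd, Real.cosh_pos _, ?_, hor', ?_, ?_, ?_⟩⟩
  · rw [Real.cosh_sq]; ring
  · exact fun i => hqmem i
  · intro i
    rw [hcosh i]
    exact (hfoot i).1
  · intro i
    have h1 := (hfoot i).2
    rw [← neg_sq (form (v i).1 (q i).1), ← hcosh i, Real.cosh_sq, add_sub_cancel_right] at h1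
    have hN : form (v (i + m)).1 (sideNormal v (i + m)) = 0 := form_cross_left _ _
    rw [← sideNormal, ← lnorm_sq (v (i + m)) hN, ← mul_pow] at h1
    exact (pow_left_inj₀ (hpos i).le
      (mul_nonneg (Real.sinh_pos_iff.mpr hd).le (lnorm_nonneg _)) two_ne_zero).mp h1

end HypPlane

theorem mainTheorem4 (n : ℕ) (V : Set HypPlane.H2) (v : ZMod n → HypPlane.H2)
    (hV : HypPlane.IsOrdinaryReducedPolygon n V v) :
    (∃ i j : ZMod n, (j = i + ((n - 1) / 2 : ℕ) ∨ j = i + ((n + 1) / 2 : ℕ)) ∧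
      HypPlane.hdist (v i) (v j) = HypPlane.hdiam V) ∧
    ∀ p ∈ V, ∀ q ∈ V, HypPlane.hdist p q = HypPlane.hdiam V →
      ∃ i j : ZMod n, p = v i ∧ q = v j ∧
        (j = i + ((n - 1) / 2 : ℕ) ∨ j = i + ((n + 1) / 2 : ℕ)) := by
  obtain ⟨hd, q, h⟩ := hV.exists_isStarPolygon
  obtain ⟨-, ⟨-, rfl, -, -⟩, ⟨hbody, hred⟩, -⟩ := hV
  have e : (n + 1) / 2 = (n - 1) / 2 + 1 := by
    have := h.card_eq
    omega
  rw [e]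
  have hle := h.height_le hd rfl hbody hred
  obtain ⟨x, hx, y, hy, hxy, hmax⟩ :=
    HypPlane.exists_isGreatest_hdist hbody.2.1 ⟨v 0, HypPlane.subset_hull _ ⟨0, rfl⟩⟩
  have key : ∀ p ∈ HypPlane.hull (Set.range v), ∀ q ∈ HypPlane.hull (Set.range v),
      HypPlane.hdist p q = HypPlane.hdiam (HypPlane.hull (Set.range v)) →
      ∃ i j : ZMod n, p = v i ∧ q = v j ∧
        (j = i + ((n - 1) / 2 : ℕ) ∨ j = i + ((n - 1) / 2 + 1 : ℕ)) := by
    intro p hp q hq hpq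
    refine h.farthest_pair hle hp hq fun a ha b hb => ?_
    have := HypPlane.hdist_le_hdist.mp ((hmax a ha b hb).trans hpq.ge)
    linarith
  refine ⟨?_, key⟩
  obtain ⟨i, j, rfl, rfl, hij⟩ := key x hx y hy hxy
  exact ⟨i, j, hij, hxy⟩
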